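/- Let $n \ge 2$ and $\ell, k \in \{1,\dots,n-1\}$. For $1\le m\le n-1$ let $\mathbb{X}_m = \mathrm{Gr}(m,n)\times\mathbb{C}^\times$, where $\mathrm{Gr}(m,n)$ is the Grassmannian of $m$-dimensional subspaces of $\mathbb{C}^n$; write a point of $\mathbb{X}_m$ as $N|t$. For a set $I$ of integers, let $P_I(N)$ be the Plücker coordinate of $N$ indexed by the set of residues in $\{1,\dots,n\}$ modulo $n$ of the elements of $I$ (rows taken in increasing order), with $P_I(N)=0$ if this set of residues does not have exactly $m$ elements. Let $\lambda$ be an indeterminate. Define the rational map $g$ from $\mathbb{X}_m$ to $n\times n$ matrices over $\mathbb{C}[\lambda]$ by $$g(N|t)_{ij} = c_{ij}\,\frac{P_{[j-m+1,\,j-1]\cup\{i\}}(N)}{P_{[j-m,\,j-1]}(N)},\qquad c_{ij}=\begin{cases}1 & j\le m\\ t & j>m,\ i\ge j\\ \lambda & j>m,\ i<j,\end{cases}$$ defined exactly where all the denominators ($1\le j\le n$) are nonzero, and set $g(u,v)=g(u)g(v)$ on products. For $z\in\mathbb{C}^\times$ and an $n \times n$ matrix $A$ over $\mathbb{C}[\lambda]$,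 let $\pi^m_z(A)=N|z$, where $N$ is the span of the first $m$ columns of $A|_{\lambda=(-1)^{m-1}z}$ (undefined if these columns are linearly dependent). Let $\mathrm{fl}(A)_{ij}=A_{n-j+1,\,n-i+1}$, let $S(N|t)=\pi^m_t(\mathrm{fl}(g(N|t)))$ on $\mathbb{X}_m$, and let $S(u,v)=(S(v),S(u))$ on products of two such varieties. Define $$\Psi_{k,\ell}:\mathbb{X}_\ell\times\mathbb{X}_k\to\mathbb{X}_k,\qquad \Psi_{k,\ell}(M|s,N|t)=\pi^k_t\big(g(M|s)\,g(N|t)\big),$$ and let the geometric $R$-matrix be $$R=(\Psi_{k,\ell},\; S\circ\Psi_{\ell,k}\circ S):\ \mathbb{X}_\ell\times\mathbb{X}_k\to\mathbb{X}_k\times\mathbb{X}_\ell .$$ Denote by $R$ also the corresponding map $\mathbb{X}_k\times\mathbb{X}_\ell\to\mathbb{X}_\ell\times\mathbb{X}_k$ (with the roles of $\ell$ and $k$ exchanged). **Lemma.** $R\circ R=\mathrm{Id}$ as rational maps from $\mathbb{X}_\ell\times\mathbb{X}_k$ to itself. That is, the composition $R\circ R$ is defined on a dense Zariski-open subset of $\mathbb{X}_\ell\times\mathbb{X}_k$,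 and $R(R(x))=x$ for every point $x$ at which it is defined (each map being defined at a point when all the steps in its construction above are). -/

import Mathlib

noncomputable section

namespace GeomR

open scoped Polynomial

/-- The Grassmannian `Gr(k, n)` of `k`-dimensional subspaces of `ℂⁿ`. -/
def Gr (n k : ℕ) : Type := {N : Submodule ℂ (Fin n → ℂ) // Module.finrank ℂ N = k}

/-- A full-rank `n × k` matrix whose columns form a basis of the subspace `N`. -/
def Gr.mat {n k : ℕ} (N : Gr n k) : Matrix (Fin n) (Fin k) ℂ :=
  fun i j => (Module.finBasisOfFinrankEq ℂ N.1 N.2 j : Fin n → ℂ) i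

/-- The maximal minor of an `n × k` matrix using the rows in `I`, in increasing order;
it is `0` if `I` does not have exactly `k` elements. -/
def minor {n k : ℕ} (A : Matrix (Fin n) (Fin k) ℂ) (I : Finset (Fin n)) : ℂ :=
  if h : I.card = k then (A.submatrix (I.orderEmbOfFin h) id).det else 0

/-- Changing the basis of the column span multiplies all maximal minors by a common scalar. -/
theorem minor_mul {n k : ℕ} (A : Matrix (Fin n) (Fin k) ℂ) (C : Matrix (Fin k) (Fin k) ℂ)
    (I : Finset (Fin n)) : minor (A * C) I = minor A I * C.det := by
  unfold minor
  split_ifs with h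
  · rw [← Matrix.det_mul, Matrix.submatrix_mul A C _ id id Function.bijective_id]
    simp
  · simp

/-- The rows of an `n`-rowed matrix carry the labels `1, …, n` (the row `r : Fin n` has the label
`r + 1`). For a set `I` of integers, `residues n I` is the set of rows whose labels are congruent
modulo `n` to elements of `I`. -/
def residues (n : ℕ) (I : Finset ℤ) : Finset (Fin n) :=
  Finset.univ.filter fun r => ∃ a ∈ I, a ≡ (r : ℤ) + 1 [ZMOD n]

/-- The Plücker coordinate `P_I(N)` for a set `I` of integers, read modulo `n`. It depends on the
matrix representative only through a nonzero factor common to all `I`; only ratios of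
Plücker coordinates are used below. -/
def plucker {n k : ℕ} (N : Gr n k) (I : Finset ℤ) : ℂ := minor N.mat (residues n I)

/-- The variety `𝕏_k = Gr(k, n) × ℂˣ`; its points are written `N|t`. -/
@[ext]
structure X (n k : ℕ) where
  /-- the subspace -/
  N : Gr n k
  /-- the nonzero complex parameter -/
  t : ℂˣ

/-! ### The Zariski topology on `𝕏_ℓ × 𝕏_k` -/

/-- Coordinates on `𝕏_ℓ × 𝕏_k`: the Plücker coordinates of the first subspace, those of the second
subspace, and the two parameters `s` (index `0`) and `t` (index `1`). -/
abbrev Coord (n ℓ k : ℕ) : Type :=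
  ({I : Finset (Fin n) // I.card = ℓ} ⊕ {I : Finset (Fin n) // I.card = k}) ⊕ Fin 2

/-- The bidegree of a coordinate. -/
def bideg (n ℓ k : ℕ) : Coord n ℓ k → ℕ × ℕ
  | Sum.inl (Sum.inl _) => (1, 0)
  | Sum.inl (Sum.inr _) => (0, 1)
  | Sum.inr _ => (0, 0)

/-- The values of the coordinates at a point of `𝕏_ℓ × 𝕏_k` (for a choice of matrix representatives
of the two subspaces). -/
def coordVal {n ℓ k : ℕ} (x : X n ℓ × X n k) : Coord n ℓ k → ℂ
  | Sum.inl (Sum.inl I) => minor x.1.N.mat I.1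
  | Sum.inl (Sum.inr I) => minor x.2.N.mat I.1
  | Sum.inr i => if i = 0 then (x.1.t : ℂ) else (x.2.t : ℂ)

/-- The set of points of `𝕏_ℓ × 𝕏_k` at which `F` does not vanish. For bihomogeneous `F`
this does not depend on the choice of matrix representatives. -/
def nonvanishing {n ℓ k : ℕ} (F : MvPolynomial (Coord n ℓ k) ℂ) : Set (X n ℓ × X n k) :=
  {x | MvPolynomial.eval (coordVal x) F ≠ 0}

/-- The Zariski topology on `𝕏_ℓ × 𝕏_k` coming from the Plücker embeddings of the two Grassmannians:
the open sets are the unions of nonvanishing sets of polynomials that are homogeneous in each of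
the two groups of Plücker coordinates. -/
@[reducible]
def zariski (n ℓ k : ℕ) : TopologicalSpace (X n ℓ × X n k) :=
  TopologicalSpace.generateFrom
    {U | ∃ (F : MvPolynomial (Coord n ℓ k) ℂ) (d : ℕ × ℕ),
      MvPolynomial.IsWeightedHomogeneous (bideg n ℓ k) F d ∧ U = nonvanishing F}

/-- Identity of two partially defined maps on `𝕏_ℓ × 𝕏_k` as rational maps: both are defined on a
common dense Zariski-open subset, and they agree wherever both are defined. -/
def RatMapEq {n ℓ k : ℕ} {Y : Type} (f g : X n ℓ × X n k →. Y) : Prop :=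
  (∃ U : Set (X n ℓ × X n k), @IsOpen _ (zariski n ℓ k) U ∧ @Dense _ (zariski n ℓ k) U ∧
    U ⊆ f.Dom ∩ g.Dom) ∧
  ∀ x ∈ f.Dom ∩ g.Dom, f x = g x

/-! ### The maps `g`, `π`, `S`, `Ψ` and the geometric `R`-matrix -/

/-- The folded matrix `g(N|t)` with entries in `ℂ[λ]`, where `λ` is the polynomial variable. The
labels of rows and columns are `i = a + 1` and `j = b + 1`. -/
def gMatrix {n k : ℕ} (x : X n k) : Matrix (Fin n) (Fin n) ℂ[X] := fun a b =>
  let i : ℤ := (a : ℤ) + 1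
  let j : ℤ := (b : ℤ) + 1
  let c : ℂ[X] := if j ≤ k then 1 else if j ≤ i then Polynomial.C (x.t : ℂ) else Polynomial.X
  c * Polynomial.C (plucker x.N (insert i (Finset.Icc (j - k + 1) (j - 1))) /
    plucker x.N (Finset.Icc (j - k) (j - 1)))

/-- The rational map `g` on `𝕏_k`; it is defined if and only if all cyclic Plücker coordinates
`P_{[j-k, j-1]}(N)`, `1 ≤ j ≤ n`, are nonzero. -/
def g {n k : ℕ} : X n k →. Matrix (Fin n) (Fin n) ℂ[X] := fun x =>
  ⟨∀ j ∈ Finset.Icc (1 : ℤ) n, plucker x.N (Finset.Icc (j - k) (j - 1)) ≠ 0, fun _ => gMatrix x⟩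

/-- The rational map `g` on `𝕏_ℓ × 𝕏_k`, `g(u, v) = g(u) g(v)`. -/
def gProd {n ℓ k : ℕ} : X n ℓ × X n k →. Matrix (Fin n) (Fin n) ℂ[X] := fun x =>
  (g x.1).bind fun A => (g x.2).map fun B => A * B

/-- The span of the first `k` columns of a square matrix. -/
def firstCols {n : ℕ} (k : ℕ) (A : Matrix (Fin n) (Fin n) ℂ) : Submodule ℂ (Fin n → ℂ) :=
  Submodule.span ℂ ((fun (j : Fin n) (i : Fin n) => A i j) '' {j | (j : ℕ) < k})

/-- The evaluation-projection `π^k_z`: evaluate `λ` at `(-1)^(k-1) z` and take the span of the first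
`k` columns. It is undefined if these columns do not have full rank. -/
def proj {n : ℕ} (k : ℕ) (z : ℂˣ) : Matrix (Fin n) (Fin n) ℂ[X] →. X n k := fun A =>
  ⟨Module.finrank ℂ (firstCols k (A.map (Polynomial.eval ((-1) ^ (k - 1) * (z : ℂ))))) = k,
    fun h => ⟨⟨_, h⟩, z⟩⟩

/-- The flip map: reflection over the anti-diagonal. -/
def flip {n : ℕ} {α : Type} (A : Matrix (Fin n) (Fin n) α) : Matrix (Fin n) (Fin n) α :=
  fun i j => A j.rev i.rev

/-- The geometric Schützenberger involution `S(N|t) = π^k_t (fl (g(N|t)))` on `𝕏_k`. -/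
def S {n k : ℕ} : X n k →. X n k := fun x => (g x).bind fun A => proj k x.t (flip A)

/-- The map `S` on products, `S(u, v) = (S(v), S(u))`. -/
def SProd {n ℓ k : ℕ} : X n ℓ × X n k →. X n k × X n ℓ := fun x => PFun.prodMap S S x.swap

/-- The rational map `Ψ_{k,ℓ}(M|s, N|t) = π^k_t (g(M|s) g(N|t))`. -/
def Psi (n k ℓ : ℕ) : X n ℓ × X n k →. X n k := fun x => (gProd x).bind fun A => proj k x.2.t A

/-- The geometric `R`-matrix `R = (Ψ_{k,ℓ}, S ∘ Ψ_{ℓ,k} ∘ S) : 𝕏_ℓ × 𝕏_k → 𝕏_k × 𝕏_ℓ`. -/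
def R (n ℓ k : ℕ) : X n ℓ × X n k →. X n k × X n ℓ :=
  PFun.prodLift (Psi n k ℓ) (S.comp ((Psi n ℓ k).comp SProd))

end GeomR

end

noncomputable section

namespace GeomR

open scoped Polynomial
open MvPolynomial (IsWeightedHomogeneous)

/-! The matrix `g(N|t)` is characterized by two properties. Unfolded into an infinite periodic
matrix it is a band: nonzero diagonal, ones on the `(n-k)`-th subdiagonal, zeros outside
(`isBand_gMatrix`). At `λ = (-1)^(k-1) t` its columns lie in `N` (`evalAt_gMatrix_mem`).
`IsBand.gMatrix_eq` shows that no other matrix has both properties. Moreover `g(N|t)` is a left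
divisor of every polynomial matrix whose columns at that value lie in `N` (`exists_gMatrix_mul`),
hence is invertible at every other value of `λ`.

It follows that `S` corresponds to the flip of matrices, which is an involution, and that for
distinct special values of `λ` the map `R` refactors the product: if `R(u, v) = (v', u')`, then
`g(v') g(u') = g(u) g(v)`, with the parameters exchanged (`gMatrix_mul_of_mem_R`). The left factor
is read off from the column space of the product at its own special value, and the right factor in
the same way from the flipped product. Applying `R` again reads off the factors in the original
order, so it returns `(u, v)` (`mem_R_symm`). When the two special values coincide, a rank count
forces `ℓ = k` wherever `R` is defined, and there `R` fixes the point.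

For the domain, it suffices that the cyclic Plücker coordinates of `u`, `v` and of the intermediate
point `w` with `u' = S(w)` are nonzero and that the special values differ. This is the nonvanishing
locus of a bihomogeneous polynomial. Nonempty basic open sets are dense, since any two points can be
joined by a line of matrix representatives (`nonvanishing_inter`). Nonemptiness is shown by
polynomials in the cyclic shift matrix: they commute and are fixed by the flip, so `w = u` there
(`exists_good_point`). -/

/-! ### Banded polynomial matrices -/

/-- Row `a` and exponent `p` of the polynomial variable correspond to the row `a + n * p` of the
unfolded (infinite periodic) matrix. In these terms, `IsBand d A` says that the unfolding of `A` is
lower triangular with nonzero diagonal, that its `d`-th subdiagonal consists of ones, and that it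
vanishes below that subdiagonal. -/
def IsBand {n : ℕ} (d : ℕ) (A : Matrix (Fin n) (Fin n) ℂ[X]) : Prop :=
  ∀ (a b : Fin n) (p : ℕ),
    ((a : ℕ) + n * p < b → (A a b).coeff p = 0) ∧
    ((a : ℕ) + n * p = b → (A a b).coeff p ≠ 0) ∧
    ((a : ℕ) + n * p = b + d → (A a b).coeff p = 1) ∧
    ((b : ℕ) + d < a + n * p → (A a b).coeff p = 0)

theorem index_le {n : ℕ} {a b : Fin n} {p q : ℕ} (h : (b : ℕ) + n * q ≤ a + n * p) : q ≤ p := by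
  have h1 : n * q < n * (p + 1) := by have := a.2; rw [mul_add]; omega
  exact Nat.lt_succ_iff.1 (lt_of_mul_lt_mul_left h1 (Nat.zero_le n))

theorem index_inj {n : ℕ} {a b : Fin n} {p q : ℕ} (h : (b : ℕ) + n * q = a + n * p) :
    b = a ∧ q = p := by
  have h1 : q = p := le_antisymm (index_le h.le) (index_le h.ge)
  subst h1
  exact ⟨Fin.ext (by omega), rfl⟩

theorem exists_index {n : ℕ} (hn : 0 < n) (r : ℕ) : ∃ (a : Fin n) (p : ℕ), (a : ℕ) + n * p = r :=
  ⟨⟨r % n, Nat.mod_lt r hn⟩, r / n, Nat.mod_add_div r n⟩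

theorem coeff_mulVec {n : ℕ} (A : Matrix (Fin n) (Fin n) ℂ[X]) (f : Fin n → ℂ[X]) (a : Fin n)
    (p : ℕ) : (A.mulVec f a).coeff p =
      ∑ b, ∑ x ∈ Finset.HasAntidiagonal.antidiagonal p, (A a b).coeff x.1 * (f b).coeff x.2 := by
  simp [Matrix.mulVec, dotProduct, Polynomial.finsetSum_coeff, Polynomial.coeff_mul]

theorem index_split {n : ℕ} {a : Fin n} {p : ℕ} {x : ℕ × ℕ}
    (hx : x ∈ Finset.HasAntidiagonal.antidiagonal p) :
    (a : ℕ) + n * p = (a + n * x.1) + n * x.2 := by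
  rw [Finset.HasAntidiagonal.mem_antidiagonal] at hx
  rw [← hx]; ring

theorem coeff_mulVec_single {n : ℕ} (A : Matrix (Fin n) (Fin n) ℂ[X]) (f : Fin n → ℂ[X])
    {a b : Fin n} {p q : ℕ} (hq : q ≤ p)
    (h : ∀ (b' : Fin n) (x : ℕ × ℕ), x.1 + x.2 = p → (b', x.2) ≠ (b, q) →
      (A a b').coeff x.1 * (f b').coeff x.2 = 0) :
    (A.mulVec f a).coeff p = (A a b).coeff (p - q) * (f b).coeff q := by
  rw [coeff_mulVec, Finset.sum_eq_single b, Finset.sum_eq_single (p - q, q)]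
  · intro x hx hne
    refine h b x (Finset.HasAntidiagonal.mem_antidiagonal.1 hx) fun he => hne ?_
    have h1 := Finset.HasAntidiagonal.mem_antidiagonal.1 hx
    have h2 : x.2 = q := (Prod.ext_iff.1 he).2
    exact Prod.ext (by omega) h2
  · intro hx
    exact absurd (Finset.HasAntidiagonal.mem_antidiagonal.2 (by omega)) hx
  · intro b' _ hb'
    refine Finset.sum_eq_zero fun x hx => h b' x (Finset.HasAntidiagonal.mem_antidiagonal.1 hx) fun he => hb' ?_
    exact (Prod.ext_iff.1 he).1
  · intro hb
    exact absurd (Finset.mem_univ _) hb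

namespace IsBand

variable {n d : ℕ} {A : Matrix (Fin n) (Fin n) ℂ[X]}

theorem coeff_mulVec_eq_zero_of_gt (hA : IsBand d A) {f : Fin n → ℂ[X]} {r : ℕ}
    (hf : ∀ (b : Fin n) (q : ℕ), r < b + n * q → (f b).coeff q = 0) {a : Fin n} {p : ℕ}
    (h : r + d < a + n * p) : (A.mulVec f a).coeff p = 0 := by
  rw [coeff_mulVec]
  refine Finset.sum_eq_zero fun b _ => Finset.sum_eq_zero fun x hx => ?_
  have hi := index_split (a := a) hx
  by_cases hr : r < b + n * x.2
  · rw [hf b x.2 hr, mul_zero]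
  · rw [(hA a b x.1).2.2.2 (by omega), zero_mul]

/-- Leading-term rule: the ones on the `d`-th subdiagonal carry the top coefficient, unchanged, `d`
positions down. -/
theorem coeff_mulVec_top (hA : IsBand d A) {f : Fin n → ℂ[X]} {b : Fin n} {q : ℕ}
    (hf : ∀ (b' : Fin n) (q' : ℕ), (b : ℕ) + n * q < b' + n * q' → (f b').coeff q' = 0)
    {a : Fin n} {p : ℕ} (h : (a : ℕ) + n * p = b + n * q + d) :
    (A.mulVec f a).coeff p = (f b).coeff q := by
  have hq : q ≤ p := index_le (a := a) (b := b) (by omega)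
  rw [coeff_mulVec_single A f (b := b) hq, (hA a b (p - q)).2.2.1, one_mul]
  · obtain ⟨e, rfl⟩ := Nat.exists_eq_add_of_le hq
    rw [Nat.add_sub_cancel_left]
    rw [mul_add] at h; omega
  · intro b' x hx hne
    have hi := index_split (a := a) (Finset.HasAntidiagonal.mem_antidiagonal.2 hx)
    rcases lt_trichotomy ((b' : ℕ) + n * x.2) (b + n * q) with h1 | h1 | h1
    · rw [(hA a b' x.1).2.2.2 (by omega), zero_mul]
    · obtain ⟨h2, h3⟩ := index_inj h1
      exact absurd (Prod.ext h2 h3) hne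
    · rw [hf _ _ h1, mul_zero]

theorem coeff_mulVec_eq_zero_of_lt (hA : IsBand d A) {f : Fin n → ℂ[X]} {r : ℕ}
    (hf : ∀ (b : Fin n) (q : ℕ), b + n * q < r → (f b).coeff q = 0) {a : Fin n} {p : ℕ}
    (h : a + n * p < r) : (A.mulVec f a).coeff p = 0 := by
  rw [coeff_mulVec]
  refine Finset.sum_eq_zero fun b _ => Finset.sum_eq_zero fun x hx => ?_
  have hi := index_split (a := a) hx
  by_cases hr : b + n * x.2 < r
  · rw [hf b x.2 hr, mul_zero]
  · rw [(hA a b x.1).1 (by omega), zero_mul]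

/-- Lowest-term rule: by triangularity only the diagonal entry contributes at the lowest position.
-/
theorem coeff_mulVec_bot (hA : IsBand d A) {f : Fin n → ℂ[X]} {a : Fin n} {p : ℕ}
    (hf : ∀ (b : Fin n) (q : ℕ), (b : ℕ) + n * q < a + n * p → (f b).coeff q = 0) :
    (A.mulVec f a).coeff p = (A a a).coeff 0 * (f a).coeff p := by
  rw [coeff_mulVec_single A f (b := a) le_rfl, Nat.sub_self]
  intro b' x hx hne
  have hi := index_split (a := a) (Finset.HasAntidiagonal.mem_antidiagonal.2 hx)
  rcases lt_trichotomy ((b' : ℕ) + n * x.2) (a + n * p) with h1 | h1 | h1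
  · rw [hf _ _ h1, mul_zero]
  · obtain ⟨h2, h3⟩ := index_inj h1
    exact absurd (Prod.ext h2 h3) hne
  · rw [(hA a b' x.1).1 (by omega), zero_mul]

theorem diag_ne_zero (hA : IsBand d A) (a : Fin n) : (A a a).coeff 0 ≠ 0 :=
  (hA a a 0).2.1 (by simp)

/-- A banded matrix can be cancelled from the left of a product of banded matrices. -/
theorem of_mul_left {e : ℕ} {B D : Matrix (Fin n) (Fin n) ℂ[X]} (hA : IsBand d A)
    (hB : IsBand (d + e) B) (h : B = A * D) : IsBand e D := by
  have hcol : ∀ a b p, (B a b).coeff p = (A.mulVec (fun i => D i b) a).coeff p := by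
    intro a b p; rw [h]; rfl
  have hup : ∀ (b c : Fin n) (q : ℕ), (b : ℕ) + e < c + n * q → (D c b).coeff q = 0 := by
    intro b
    by_contra hcon
    push Not at hcon
    obtain ⟨c₀, q₀, h₀, h₀'⟩ := hcon
    have hfin : Set.Finite {x : Fin n × ℕ | (D x.1 b).coeff x.2 ≠ 0} := by
      have : {x : Fin n × ℕ | (D x.1 b).coeff x.2 ≠ 0} ⊆
          Set.univ ×ˢ (⋃ c, ((D c b).support : Set ℕ)) := by
        rintro ⟨c, q⟩ hx
        refine ⟨trivial, Set.mem_iUnion.2 ⟨c, ?_⟩⟩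
        simpa using hx
      exact (Set.finite_univ.prod (Set.finite_iUnion fun c => Finset.finite_toSet _)).subset this
    -- The lowest-lying nonzero coefficient of column `b` would reappear `d` positions further down
    -- in `B`, outside the band of `B`.
    obtain ⟨⟨c, q⟩, hmem, hmax⟩ := Set.exists_max_image _
      (fun x : Fin n × ℕ => (x.1 : ℕ) + n * x.2) hfin ⟨(c₀, q₀), h₀'⟩
    have hbig := hmax (c₀, q₀) h₀'
    simp only at hbig hmem
    have hn : 0 < n := lt_of_le_of_lt (Nat.zero_le _) b.2
    obtain ⟨a, p, hap⟩ := exists_index hn (c + n * q + d)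
    have h1 := hA.coeff_mulVec_top (f := fun i => D i b) (b := c) (q := q) (fun b' q' hlt => by
      by_contra h2
      have := hmax (b', q') h2
      simp only at this
      omega) hap
    rw [← hcol, (hB a b p).2.2.2 (by omega)] at h1
    exact hmem h1.symm
  have hlow : ∀ (b : Fin n) (r : ℕ) (c : Fin n) (q : ℕ), (c : ℕ) + n * q = r → r < b →
      (D c b).coeff q = 0 := by
    intro b r
    induction r using Nat.strong_induction_on with
    | _ r ih =>
      intro c q hr hb
      have h1 := hA.coeff_mulVec_bot (f := fun i => D i b) (a := c) (p := q) (fun c' q' hlt =>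
        ih _ (by omega) c' q' rfl (by omega))
      rw [← hcol, (hB c b q).1 (by omega)] at h1
      exact (mul_eq_zero.1 h1.symm).resolve_left (hA.diag_ne_zero c)
  intro a b p
  refine ⟨fun h1 => hlow b _ a p rfl h1, fun h1 => ?_, fun h1 => ?_, fun h1 => hup b a p h1⟩
  · have h2 := hA.coeff_mulVec_bot (f := fun i => D i b) (a := a) (p := p) (fun c' q' hlt =>
        hlow b _ c' q' rfl (by omega))
    rw [← hcol] at h2
    intro h3
    rw [h3, mul_zero] at h2
    exact (hB a b p).2.1 h1 h2
  · have hn : 0 < n := lt_of_le_of_lt (Nat.zero_le _) b.2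
    obtain ⟨c, q, hcq⟩ := exists_index hn (a + n * p + d)
    have h2 := hA.coeff_mulVec_top (f := fun i => D i b) (b := a) (q := p) (fun c' q' hlt =>
      hup b c' q' (by omega)) hcq
    rw [← h2, ← hcol, (hB c b q).2.2.1 (by omega)]

theorem mul {e : ℕ} {D : Matrix (Fin n) (Fin n) ℂ[X]} (hA : IsBand d A) (hD : IsBand e D) :
    IsBand (d + e) (A * D) := by
  have hcol : ∀ a b p, ((A * D) a b).coeff p = (A.mulVec (fun i => D i b) a).coeff p :=
    fun _ _ _ => rfl
  intro a b p
  rw [hcol]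
  refine ⟨fun h => ?_, fun h => ?_, fun h => ?_, fun h => ?_⟩
  · exact hA.coeff_mulVec_eq_zero_of_lt (fun c q hc => (hD c b q).1 hc) h
  · rw [hA.coeff_mulVec_bot (fun c q hc => (hD c b q).1 (by omega))]
    exact mul_ne_zero (hA.diag_ne_zero a) ((hD a b p).2.1 h)
  · have hn : 0 < n := lt_of_le_of_lt (Nat.zero_le _) b.2
    obtain ⟨c, q, hcq⟩ := exists_index hn (b + e)
    rw [hA.coeff_mulVec_top (b := c) (q := q) (fun c' q' hc => (hD c' b q').2.2.2 (by omega))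
      (by omega), (hD c b q).2.2.1 hcq]
  · exact hA.coeff_mulVec_eq_zero_of_gt (r := b + e) (fun c q hc => (hD c b q).2.2.2 hc)
      (by omega)

theorem flip (hA : IsBand d A) : IsBand d (flip A) := by
  intro a b p
  have h := hA b.rev a.rev p
  have ha := a.2
  have hb := b.2
  simp only [Fin.val_rev] at h
  simp only [GeomR.flip]
  exact ⟨fun h1 => h.1 (by omega), fun h1 => h.2.1 (by omega), fun h1 => h.2.2.1 (by omega),
    fun h1 => h.2.2.2 (by omega)⟩

end IsBand

/-! ### The flip as an anti-automorphism -/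

theorem flip_mul {n : ℕ} {α : Type} [CommRing α] (A B : Matrix (Fin n) (Fin n) α) :
    flip (A * B) = flip B * flip A := by
  ext i j
  simp only [flip, Matrix.mul_apply]
  rw [← Equiv.sum_comp Fin.revPerm]
  simp [mul_comm]

theorem flip_flip {n : ℕ} {α : Type} (A : Matrix (Fin n) (Fin n) α) : flip (flip A) = A := by
  ext i j
  simp [flip]

/-! ### Representatives of points of the Grassmannian -/

namespace Gr

variable {n k : ℕ} (N : Gr n k)

theorem mat_mulVec (c : Fin k → ℂ) : N.mat.mulVec c =
    ((Module.finBasisOfFinrankEq ℂ N.1 N.2).equivFun.symm c : N.1) := by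
  ext i
  simp [Matrix.mulVec, dotProduct, Gr.mat, Module.Basis.equivFun_symm_apply, mul_comm]

theorem mat_mulVec_mem (c : Fin k → ℂ) : N.mat.mulVec c ∈ N.1 := by
  rw [mat_mulVec]; exact Subtype.mem _

theorem mat_mulVec_injective : Function.Injective N.mat.mulVec := by
  intro c c' h
  rw [mat_mulVec, mat_mulVec] at h
  exact (LinearEquiv.injective _) (Subtype.ext h)

theorem exists_mat_mulVec {w : Fin n → ℂ} (hw : w ∈ N.1) : ∃ c, N.mat.mulVec c = w := by
  refine ⟨(Module.finBasisOfFinrankEq ℂ N.1 N.2).equivFun ⟨w, hw⟩, ?_⟩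
  rw [mat_mulVec, LinearEquiv.symm_apply_apply]

theorem exists_mat_mul {m : ℕ} {B : Matrix (Fin n) (Fin m) ℂ} (hB : ∀ j, (fun i => B i j) ∈ N.1) :
    ∃ C : Matrix (Fin k) (Fin m) ℂ, B = N.mat * C := by
  choose c hc using fun j => N.exists_mat_mulVec (hB j)
  refine ⟨fun i j => c j i, ?_⟩
  ext i j
  exact (congrFun (hc j) i).symm

/-- Nonvanishing of a Plücker coordinate becomes injectivity of the restriction of `N` to the rows
in `I`; the uniqueness and division arguments use it in this form. -/
theorem minor_mat_ne_zero_iff {I : Finset (Fin n)} (hI : I.card = k) :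
    minor N.mat I ≠ 0 ↔ ∀ w ∈ N.1, (∀ r ∈ I, w r = 0) → w = 0 := by
  rw [minor, dif_pos hI, ← not_iff_not, not_not, ← Matrix.exists_mulVec_eq_zero_iff]
  constructor
  · rintro ⟨c, hc, h⟩ hcon
    refine hc (N.mat_mulVec_injective ?_)
    rw [Matrix.mulVec_zero]
    refine hcon _ (N.mat_mulVec_mem c) fun r hr => ?_
    obtain ⟨j, rfl⟩ : r ∈ Set.range (I.orderEmbOfFin hI) := by
      rw [Finset.range_orderEmbOfFin]; exact hr
    exact congrFun h j
  · intro hcon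
    push Not at hcon
    obtain ⟨w, hw, hz, hne⟩ := hcon
    obtain ⟨c, rfl⟩ := N.exists_mat_mulVec hw
    refine ⟨c, ?_, ?_⟩
    · rintro rfl
      exact hne (Matrix.mulVec_zero _)
    · ext j
      exact hz _ (Finset.orderEmbOfFin_mem I hI j)

end Gr

/-! ### Laplace expansion of a minor along an inserted row -/

/-- The coefficients of the Laplace expansion of a maximal minor along a row added to `I`. -/
def cofactorVec {n k : ℕ} (A : Matrix (Fin n) (Fin (k + 1)) ℂ) (I : Finset (Fin n))
    (h : I.card = k) (j : Fin (k + 1)) : ℂ :=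
  (-1) ^ (j : ℕ) * (A.submatrix (I.orderEmbOfFin h) j.succAbove).det

theorem mulVec_cofactorVec_of_mem {n k : ℕ} (A : Matrix (Fin n) (Fin (k + 1)) ℂ)
    {I : Finset (Fin n)} (h : I.card = k) {a : Fin n} (ha : a ∈ I) :
    A.mulVec (cofactorVec A I h) a = 0 := by
  obtain ⟨j, hj⟩ : a ∈ Set.range (I.orderEmbOfFin h) := by
    rw [Finset.range_orderEmbOfFin]; exact ha
  let B : Matrix (Fin (k + 1)) (Fin (k + 1)) ℂ :=
    A.submatrix (Fin.cons a (I.orderEmbOfFin h) : Fin (k + 1) → Fin n) id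
  have h1 : B.det = 0 := by
    refine Matrix.det_zero_of_row_eq (i := 0) (j := j.succ) (Fin.succ_ne_zero j).symm ?_
    ext c
    simp [B, hj]
  rw [Matrix.det_succ_row_zero] at h1
  rw [← h1]
  simp only [Matrix.mulVec, dotProduct, cofactorVec]
  refine Finset.sum_congr rfl fun c _ => ?_
  have : B.submatrix Fin.succ c.succAbove = A.submatrix (I.orderEmbOfFin h) c.succAbove := by
    ext i' j'; simp [B]
  rw [this]
  simp only [B, Matrix.submatrix_apply, Fin.cons_zero, id]
  ring

theorem minor_insert {n k : ℕ} (A : Matrix (Fin n) (Fin (k + 1)) ℂ)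
    {I : Finset (Fin n)} (h : I.card = k) {a : Fin n} (ha : a ∉ I) :
    minor A (insert a I) =
      (-1) ^ (I.filter (· < a)).card * A.mulVec (cofactorVec A I h) a := by
  have hc : (insert a I).card = k + 1 := by rw [Finset.card_insert_of_notMem ha, h]
  have hple : (I.filter (· < a)).card < k + 1 := by
    have := Finset.card_filter_le I (· < a); omega
  set p : Fin (k + 1) := ⟨(I.filter (· < a)).card, hple⟩ with hp
  set σ := I.orderEmbOfFin h with hσ
  -- The number of elements of `I` below `a` is the place of `a` in the increasing enumeration of
  -- `insert a I`, which fixes the sign in the expansion.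
  have hlt : ∀ i : Fin k, σ i < a ↔ (i : ℕ) < p := by
    intro i
    have himg : I.filter (· < a) = (Finset.univ.filter fun j => σ j < a).image σ := by
      ext r
      simp only [Finset.mem_filter, Finset.mem_image, Finset.mem_univ, true_and]
      constructor
      · rintro ⟨hr, hra⟩
        obtain ⟨j, rfl⟩ : r ∈ Set.range σ := by
          rw [hσ, Finset.range_orderEmbOfFin]; exact hr
        exact ⟨j, hra, rfl⟩
      · rintro ⟨j, hj, rfl⟩
        exact ⟨Finset.orderEmbOfFin_mem I h j, hj⟩
    have hcard : (p : ℕ) = (Finset.univ.filter fun j => σ j < a).card := by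
      rw [hp]; simp only; rw [himg, Finset.card_image_of_injective _ σ.injective]
    rw [hcard]
    constructor
    · intro hi
      have : Finset.Iic i ⊆ Finset.univ.filter fun j => σ j < a := by
        intro j hj
        simp only [Finset.mem_filter, Finset.mem_univ, true_and]
        exact lt_of_le_of_lt (σ.monotone (Finset.mem_Iic.1 hj)) hi
      have := Finset.card_le_card this
      rw [Fin.card_Iic] at this
      omega
    · intro hi
      by_contra hcon
      have : (Finset.univ.filter fun j => σ j < a) ⊆ Finset.Iio i := by
        intro j hj
        simp only [Finset.mem_filter, Finset.mem_univ, true_and] at hj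
        rw [Finset.mem_Iio]
        by_contra hji
        exact hcon (lt_of_le_of_lt (σ.monotone (not_lt.1 hji)) hj)
      have := Finset.card_le_card this
      rw [Fin.card_Iio] at this
      omega
  have hne : ∀ i, σ i ≠ a := fun i hi => ha (hi ▸ Finset.orderEmbOfFin_mem I h i)
  let τ : Fin (k + 1) → Fin n := p.insertNth a σ
  have hτp : τ p = a := by simp [τ]
  have hτs : ∀ i, τ (p.succAbove i) = σ i := fun i => by simp [τ]
  have hmono : StrictMono τ := by
    intro x y hxy
    rcases Fin.eq_self_or_eq_succAbove p x with rfl | ⟨i, rfl⟩ <;>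
      rcases Fin.eq_self_or_eq_succAbove p y with hy | ⟨j, rfl⟩
    · exact absurd hxy (by rw [hy]; exact lt_irrefl _)
    · rw [hτp, hτs]
      have : ¬ σ j < a := by
        rw [hlt]
        intro hj
        rw [Fin.succAbove_of_castSucc_lt _ _ (Fin.lt_def.2 (by simpa using hj))] at hxy
        have := Fin.lt_def.1 hxy
        simp at this; omega
      exact lt_of_le_of_ne (not_lt.1 this) (hne j).symm
    · rw [hy] at hxy ⊢
      rw [hτp, hτs, hlt]
      by_contra hi
      rw [Fin.succAbove_of_le_castSucc _ _ (Fin.le_def.2 (by simpa using hi))] at hxy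
      have := Fin.lt_def.1 hxy
      simp at this; omega
    · rw [hτs, hτs]
      exact σ.strictMono ((Fin.strictMono_succAbove p).lt_iff_lt.1 hxy)
  have hemb : τ = (insert a I).orderEmbOfFin hc := by
    refine Finset.orderEmbOfFin_unique hc (fun x => ?_) hmono
    rcases Fin.eq_self_or_eq_succAbove p x with rfl | ⟨i, rfl⟩
    · rw [hτp]; exact Finset.mem_insert_self _ _
    · rw [hτs]; exact Finset.mem_insert_of_mem (Finset.orderEmbOfFin_mem I h i)
  rw [minor, dif_pos hc, ← hemb, Matrix.det_succ_row _ p, Matrix.mulVec, dotProduct, Finset.mul_sum]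
  refine Finset.sum_congr rfl fun c _ => ?_
  have h3 : ((A.submatrix τ id).submatrix p.succAbove c.succAbove) =
      A.submatrix σ c.succAbove := by
    ext i' j'; simp [hτs]
  rw [h3, cofactorVec, Matrix.submatrix_apply, hτp, pow_add]
  simp only [id, hp]
  ring

/-! ### Cyclic intervals of rows -/

/-- The rows in the cyclic interval of length `k` that ends just before row `b`. -/
def cyc (n k b : ℕ) : Finset (Fin n) :=
  Finset.univ.filter fun r => ((r : ℕ) < b ∧ b ≤ r + k) ∨ n + b ≤ r + k

theorem mem_cyc {n k b : ℕ} {r : Fin n} :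
    r ∈ cyc n k b ↔ ((r : ℕ) < b ∧ b ≤ r + k) ∨ n + b ≤ r + k := by
  simp [cyc]

theorem card_cyc {n k b : ℕ} (hk : k ≤ n) (hb : b ≤ n) : (cyc n k b).card = k := by
  rw [← Finset.card_map Fin.valEmbedding]
  have : (cyc n k b).map Fin.valEmbedding = Finset.Ico (b - k) b ∪ Finset.Ico (n + b - k) n := by
    ext r
    simp only [Finset.mem_map, mem_cyc, Fin.valEmbedding_apply, Finset.mem_union, Finset.mem_Ico]
    constructor
    · rintro ⟨x, hx, rfl⟩
      have := x.2
      omega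
    · intro h
      exact ⟨⟨r, by omega⟩, by simp only; omega, rfl⟩
  rw [this, Finset.card_union_of_disjoint, Nat.card_Ico, Nat.card_Ico]
  · omega
  · rw [Finset.disjoint_left]
    intro r
    simp only [Finset.mem_Ico]
    omega

theorem residues_Icc {n k b : ℕ} (hk : k ≤ n) (hb : b ≤ n) :
    residues n (Finset.Icc ((b : ℤ) + 1 - k) b) = cyc n k b := by
  ext r
  have hr := r.2
  simp only [residues, Finset.mem_filter, Finset.mem_univ, true_and, mem_cyc, Finset.mem_Icc]
  constructor
  · rintro ⟨x, ⟨h1, h2⟩, h3⟩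
    obtain ⟨z, hz⟩ := h3.dvd
    -- An interval of at most `n` labels ending at `b` in `[0, n]` wraps around at most once.
    have hz0 : z = 0 ∨ z = 1 := by
      have h4 : -1 < z := by
        by_contra hcon
        nlinarith
      have h5 : z < 2 := by
        by_contra hcon
        nlinarith
      omega
    rcases hz0 with rfl | rfl <;> omega
  · rintro (h | h)
    · exact ⟨r + 1, by omega, Int.ModEq.refl _⟩
    · refine ⟨r + 1 - n, by omega, ?_⟩
      exact (Int.modEq_iff_dvd.2 ⟨1, by ring⟩)

theorem residues_insert {n : ℕ} (a : Fin n) (I : Finset ℤ) :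
    residues n (insert ((a : ℤ) + 1) I) = insert a (residues n I) := by
  ext r
  simp only [residues, Finset.mem_filter, Finset.mem_univ, true_and, Finset.mem_insert,
    exists_eq_or_imp]
  refine or_congr ⟨fun h => ?_, fun h => by rw [h]⟩ Iff.rfl
  have h1 : (a : ℤ) ≡ r [ZMOD n] := Int.ModEq.add_right_cancel' 1 h
  have h2 := Int.emod_eq_emod_iff_emod_sub_eq_zero.1 h1
  rw [Int.ModEq, Int.emod_eq_of_lt (by omega) (by have := a.2; omega),
    Int.emod_eq_of_lt (by omega) (by have := r.2; omega)] at h1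
  exact Fin.ext (by omega)

theorem insert_cyc {n k b : ℕ} {a : Fin n}
    (h : (a : ℕ) + (k + 1) = b ∨ (a : ℕ) + (k + 1) = n + b) :
    insert a (cyc n k b) = cyc n (k + 1) b := by
  ext r
  have := r.2
  have := a.2
  rw [Finset.mem_insert, mem_cyc, mem_cyc, Fin.ext_iff]
  omega

theorem insert_cyc_self {n k : ℕ} (b : Fin n) :
    insert b (cyc n k b) = cyc n (k + 1) (b + 1) := by
  ext r
  have := r.2
  have := b.2
  rw [Finset.mem_insert, mem_cyc, mem_cyc, Fin.ext_iff]
  omega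

theorem cyc_self {n k : ℕ} : cyc n k n = cyc n k 0 := by
  ext r
  have := r.2
  rw [mem_cyc, mem_cyc]
  omega

/-! ### Characterization of the matrix `g(N|t)` -/

/-- Evaluation of a polynomial matrix at `λ = μ`. -/
def evalAt {n : ℕ} (μ : ℂ) (A : Matrix (Fin n) (Fin n) ℂ[X]) : Matrix (Fin n) (Fin n) ℂ :=
  A.map (Polynomial.eval μ)

theorem evalAt_apply {n : ℕ} (μ : ℂ) (A : Matrix (Fin n) (Fin n) ℂ[X]) (a b : Fin n) :
    evalAt μ A a b = (A a b).eval μ := rfl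

theorem evalAt_mul {n : ℕ} (μ : ℂ) (A B : Matrix (Fin n) (Fin n) ℂ[X]) :
    evalAt μ (A * B) = evalAt μ A * evalAt μ B :=
  Matrix.map_mul (f := Polynomial.evalRingHom μ)

theorem evalAt_flip {n : ℕ} (μ : ℂ) (A : Matrix (Fin n) (Fin n) ℂ[X]) :
    evalAt μ (flip A) = flip (evalAt μ A) := rfl

/-- The special value `(-1)^(k-1) t` of `λ` attached to `N|t`. -/
def lam {n k : ℕ} (x : X n k) : ℂ := (-1) ^ (k - 1) * (x.t : ℂ)

theorem lam_ne_zero {n k : ℕ} (x : X n k) : lam x ≠ 0 :=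
  mul_ne_zero (pow_ne_zero _ (neg_ne_zero.2 one_ne_zero)) x.t.ne_zero

/-- All cyclic Plücker coordinates are nonzero. -/
def IsGen {n k : ℕ} (x : X n k) : Prop := ∀ b : Fin n, minor x.N.mat (cyc n k b) ≠ 0

theorem plucker_cyc {n k : ℕ} (hk : k ≤ n) (N : Gr n k) {b : ℕ} (hb : b ≤ n) :
    plucker N (Finset.Icc ((b : ℤ) + 1 - k) ((b : ℤ) + 1 - 1)) = minor N.mat (cyc n k b) := by
  rw [plucker, add_sub_cancel_right, residues_Icc hk hb]

theorem g_dom_iff {n k : ℕ} (hk : k ≤ n) (x : X n k) : (g x).Dom ↔ IsGen x := by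
  constructor
  · intro h b
    have h1 := h ((b : ℤ) + 1) (Finset.mem_Icc.2 (by have := b.2; omega))
    rwa [plucker_cyc hk _ b.2.le] at h1
  · intro h j hj
    rw [Finset.mem_Icc] at hj
    obtain ⟨b, rfl⟩ : ∃ b : ℕ, j = (b : ℤ) + 1 := ⟨(j - 1).toNat, by omega⟩
    rw [plucker_cyc hk _ (by omega)]
    exact h ⟨b, by omega⟩

theorem mem_g_iff {n k : ℕ} (hk : k ≤ n) (x : X n k) (A : Matrix (Fin n) (Fin n) ℂ[X]) :
    A ∈ g x ↔ IsGen x ∧ gMatrix x = A := by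
  rw [← g_dom_iff hk]
  exact ⟨fun ⟨h, h'⟩ => ⟨h, h'⟩, fun ⟨h, h'⟩ => ⟨h, h'⟩⟩

theorem gMatrix_apply {n k : ℕ} (hk : 1 ≤ k) (hkn : k < n) (x : X n k) (a b : Fin n) :
    gMatrix x a b =
      (if (b : ℕ) < k then 1 else if b ≤ a then Polynomial.C (x.t : ℂ) else Polynomial.X) *
        Polynomial.C (minor x.N.mat (insert a (cyc n (k - 1) b)) /
          minor x.N.mat (cyc n k b)) := by
  have h1 : Finset.Icc ((b : ℤ) + 1 - k + 1) ((b : ℤ) + 1 - 1) =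
      Finset.Icc ((b : ℤ) + 1 - ((k - 1 : ℕ) : ℤ)) (b : ℕ) := by
    congr 1 <;> omega
  simp only [gMatrix]
  rw [plucker_cyc hkn.le _ b.2.le, h1, plucker, residues_insert,
    residues_Icc (by omega) b.2.le]
  congr 1
  have e1 : ((b : ℤ) + 1 ≤ (k : ℤ)) ↔ (b : ℕ) < k := by omega
  have e2 : ((b : ℤ) + 1 ≤ (a : ℤ) + 1) ↔ b ≤ a := by rw [Fin.le_def]; omega
  simp only [e1, e2]

theorem minor_eq_zero {n k : ℕ} (A : Matrix (Fin n) (Fin k) ℂ) {I : Finset (Fin n)}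
    (h : I.card ≠ k) : minor A I = 0 := dif_neg h

theorem minor_insert_mem {n k : ℕ} (hk : 1 ≤ k) (hkn : k < n) (A : Matrix (Fin n) (Fin k) ℂ)
    {a b : Fin n} (h : a ∈ cyc n (k - 1) b) : minor A (insert a (cyc n (k - 1) b)) = 0 := by
  refine minor_eq_zero A ?_
  rw [Finset.insert_eq_of_mem h, card_cyc (by omega) b.2.le]
  omega

theorem minor_cyc_ne_zero {n k : ℕ} {x : X n k} (h : IsGen x) (hn : 0 < n) {b : ℕ} (hb : b ≤ n) :
    minor x.N.mat (cyc n k b) ≠ 0 := by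
  rcases hb.lt_or_eq with hb | rfl
  · exact h ⟨b, hb⟩
  · rw [cyc_self]; exact h ⟨0, hn⟩

/-- Entries outside the band vanish because a row would be repeated. On the `(n-k)`-th subdiagonal
the inserted row completes the interval of the denominator, so the ratio is `1`; on the diagonal it
is a ratio of two consecutive cyclic Plücker coordinates. The factor `c` supplies the power of `λ`
that puts each entry in its unfolded position. -/
theorem isBand_gMatrix {n k : ℕ} (hk : 1 ≤ k) (hkn : k < n) {x : X n k} (hx : IsGen x) :
    IsBand (n - k) (gMatrix x) := by
  have hkk : k - 1 + 1 = k := by omega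
  intro a b p
  have ha := a.2
  have hb := b.2
  have hzero : a ∈ cyc n (k - 1) b → (gMatrix x a b).coeff p = 0 := by
    intro h
    rw [gMatrix_apply hk hkn, minor_insert_mem hk hkn _ h]
    simp
  have hdiag : minor x.N.mat (insert b (cyc n (k - 1) b)) / minor x.N.mat (cyc n k b) ≠ 0 := by
    refine div_ne_zero ?_ (hx b)
    rw [insert_cyc_self b, hkk]
    exact minor_cyc_ne_zero hx (by omega) (by omega)
  have htop : ((a : ℕ) + k = b ∨ (a : ℕ) + k = n + b) →
      minor x.N.mat (insert a (cyc n (k - 1) b)) / minor x.N.mat (cyc n k b) = 1 := by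
    intro h
    rw [insert_cyc (by omega), hkk]
    exact div_self (hx b)
  have hp : p = 0 ∧ n * p = 0 ∨ p = 1 ∧ n * p = n ∨ 2 ≤ p ∧ 2 * n ≤ n * p := by
    rcases p with _ | _ | p
    · simp
    · simp
    · right; right; refine ⟨by omega, ?_⟩; nlinarith
  refine ⟨fun h => ?_, fun h => ?_, fun h => ?_, fun h => ?_⟩
  · obtain ⟨rfl, -⟩ : p = 0 ∧ n * p = 0 := by omega
    by_cases hbk : (b : ℕ) < k
    · exact hzero (mem_cyc.2 (by omega))
    · rw [gMatrix_apply hk hkn, if_neg hbk, if_neg (by rw [Fin.le_def]; omega)]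
      simp
  · obtain ⟨rfl, -⟩ : p = 0 ∧ n * p = 0 := by omega
    obtain rfl : a = b := Fin.ext (by omega)
    rw [gMatrix_apply hk hkn, Polynomial.coeff_mul_C]
    refine mul_ne_zero ?_ hdiag
    split_ifs <;> simp_all
  · rw [gMatrix_apply hk hkn, Polynomial.coeff_mul_C, htop (by omega), mul_one]
    by_cases hbk : (b : ℕ) < k
    · obtain ⟨rfl, -⟩ : p = 0 ∧ n * p = 0 := by omega
      simp [hbk]
    · obtain ⟨rfl, -⟩ : p = 1 ∧ n * p = n := by omega
      rw [if_neg hbk, if_neg (by rw [Fin.le_def]; omega)]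
      simp
  · by_cases hm : a ∈ cyc n (k - 1) b
    · exact hzero hm
    rw [mem_cyc] at hm
    rw [gMatrix_apply hk hkn, Polynomial.coeff_mul_C]
    refine mul_eq_zero_of_left ?_ _
    split_ifs with h1 h2
    · rw [Polynomial.coeff_one, if_neg (by omega)]
    · rw [Fin.le_def] at h2
      rw [Polynomial.coeff_C, if_neg (by omega)]
    · rw [Fin.le_def] at h2
      rw [Polynomial.coeff_X, if_neg (by omega)]

/-- The columns of `g(N|t)`, evaluated at `λ = (-1)^(k-1) t`, lie in `N`. -/
theorem evalAt_gMatrix_mem {n k : ℕ} (hk : 1 ≤ k) (hkn : k < n) (x : X n k) (b : Fin n) :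
    (fun a => evalAt (lam x) (gMatrix x) a b) ∈ x.N.1 := by
  obtain ⟨m, rfl⟩ : ∃ m, k = m + 1 := ⟨k - 1, by omega⟩
  have hb := b.2
  set I := cyc n m b with hI
  have hcard : I.card = m := card_cyc (by omega) hb.le
  set w := x.N.mat.mulVec (cofactorVec x.N.mat I hcard) with hw
  have hwmem : w ∈ x.N.1 := x.N.mat_mulVec_mem _
  -- Column `b` is a multiple of one cofactor vector, provided the sorting signs do not depend on
  -- `a`. For `b ≤ m` every `a ∉ I` has exactly `b` elements of `I` below it. For `b > m` there are
  -- `m` of them if `a ≥ b` and none if `a < b`, and the values `t` and `λ = (-1)^m t` of `c`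
  -- compensate for the difference.
  set γ : ℂ := (if (b : ℕ) < m + 1 then (-1) ^ (b : ℕ) else (-1) ^ m * (x.t : ℂ)) with hγ
  have key : (fun a => evalAt (lam x) (gMatrix x) a b) =
      (γ / minor x.N.mat (cyc n (m + 1) b)) • w := by
    funext a
    have ha := a.2
    rw [evalAt_apply, gMatrix_apply hk hkn, Nat.add_sub_cancel, ← hI, Pi.smul_apply, smul_eq_mul,
      Polynomial.eval_mul, Polynomial.eval_C, div_mul_eq_mul_div, mul_div_assoc']
    congr 1
    by_cases hm : a ∈ I
    · have h0 := minor_insert_mem hk hkn x.N.mat (a := a) (b := b) hm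
      rw [Nat.add_sub_cancel, ← hI] at h0
      rw [h0, hw, mulVec_cofactorVec_of_mem _ _ hm, mul_zero, mul_zero]
    · rw [minor_insert _ hcard hm, ← hw, ← mul_assoc]
      congr 1
      have hm' := hm
      rw [hI, mem_cyc] at hm'
      by_cases hbm : (b : ℕ) < m + 1
      · have hf : I.filter (· < a) = Finset.Iio b := by
          ext r
          rw [Finset.mem_filter, hI, mem_cyc, Finset.mem_Iio, Fin.lt_def, Fin.lt_def]
          omega
        rw [hf, Fin.card_Iio, hγ, if_pos hbm, if_pos hbm, Polynomial.eval_one, one_mul]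
      · rw [hγ, if_neg hbm, if_neg hbm]
        by_cases hab : b ≤ a
        · have hf : I.filter (· < a) = I := by
            ext r
            rw [Fin.le_def] at hab
            rw [Finset.mem_filter, hI, mem_cyc, Fin.lt_def]
            omega
          rw [hf, hcard, if_pos hab, Polynomial.eval_C, mul_comm]
        · have hf : I.filter (· < a) = ∅ := by
            ext r
            rw [Fin.le_def] at hab
            rw [Finset.mem_filter, hI, mem_cyc, Fin.lt_def]
            simp only [Finset.notMem_empty, iff_false]
            omega
          rw [hf, Finset.card_empty, pow_zero, mul_one, if_neg hab, Polynomial.eval_X, lam,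
            Nat.add_sub_cancel]
  rw [key]
  exact x.N.1.smul_mem _ hwmem

/-! ### First columns -/

/-- The first `k` columns of a square matrix. -/
def firstBlock {n k : ℕ} (h : k ≤ n) (A : Matrix (Fin n) (Fin n) ℂ) : Matrix (Fin n) (Fin k) ℂ :=
  A.submatrix id (Fin.castLE h)

theorem firstCols_eq {n k : ℕ} (h : k ≤ n) (A : Matrix (Fin n) (Fin n) ℂ) :
    firstCols k A = Submodule.span ℂ (Set.range (firstBlock h A).col) := by
  rw [firstCols]
  congr 1
  ext v
  constructor
  · rintro ⟨j, hj, rfl⟩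
    exact ⟨⟨j, hj⟩, rfl⟩
  · rintro ⟨j, rfl⟩
    exact ⟨Fin.castLE h j, j.2, rfl⟩

theorem finrank_firstCols_iff {n k : ℕ} (h : k ≤ n) (A : Matrix (Fin n) (Fin n) ℂ) :
    Module.finrank ℂ (firstCols k A) = k ↔
      ∀ c : Fin k → ℂ, (firstBlock h A).mulVec c = 0 → c = 0 := by
  rw [firstCols_eq h]
  have h1 := linearIndependent_iff_card_eq_finrank_span (R := ℂ) (b := (firstBlock h A).col)
  rw [Fintype.card_fin, eq_comm] at h1
  rw [show Module.finrank ℂ (Submodule.span ℂ (Set.range (firstBlock h A).col)) = k ↔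
      LinearIndependent ℂ (firstBlock h A).col from h1.symm,
    ← Matrix.mulVec_injective_iff]
  constructor
  · intro hi c hc
    exact hi (by rw [hc, Matrix.mulVec_zero])
  · intro hi c c' hc
    have := hi (c - c') (by rw [Matrix.mulVec_sub, sub_eq_zero]; exact hc)
    exact sub_eq_zero.1 this

/-- In a banded matrix, the last rows of the first columns form a unitriangular matrix. -/
theorem IsBand.firstBlock_eq_zero {n k : ℕ} (hkn : k < n) {A : Matrix (Fin n) (Fin n) ℂ[X]}
    (hA : IsBand (n - k) A) (μ : ℂ) {c : Fin k → ℂ}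
    (hc : ∀ r : Fin n, n ≤ r + k → (firstBlock hkn.le (evalAt μ A)).mulVec c r = 0) : c = 0 := by
  -- In the last `k` rows, row `n - k + j` meets the subdiagonal of ones exactly in column `j`;
  -- everything to the left is below the band.
  let ρ : Fin k → Fin n := fun r => ⟨n - k + r, by have := r.2; omega⟩
  let T : Matrix (Fin k) (Fin k) ℂ := (firstBlock hkn.le (evalAt μ A)).submatrix ρ id
  have hT : ∀ r j : Fin k, j ≤ r → T r j = if r = j then 1 else 0 := by
    intro r j hjr
    have hr := r.2
    have hj := j.2
    rw [Fin.le_def] at hjr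
    have hpoly : A (ρ r) (Fin.castLE hkn.le j) = if r = j then 1 else 0 := by
      ext p
      have hp : p = 0 ∧ n * p = 0 ∨ 0 < p ∧ n ≤ n * p := by
        rcases p with _ | p
        · simp
        · right; exact ⟨by omega, Nat.le_mul_of_pos_right n (by omega)⟩
      have hA' := hA (ρ r) (Fin.castLE hkn.le j) p
      simp only [ρ, Fin.val_castLE] at hA'
      rcases hp with ⟨rfl, hp⟩ | ⟨hp, hp'⟩
      · split_ifs with h
        · rw [hA'.2.2.1 (by subst h; omega)]; simp
        · rw [Fin.ext_iff] at h
          rw [hA'.2.2.2 (by omega)]; simp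
      · rw [hA'.2.2.2 (by omega)]
        split_ifs <;> simp [Polynomial.coeff_one, hp.ne']
    change (A (ρ r) (Fin.castLE hkn.le j)).eval μ = _
    rw [hpoly]
    split_ifs <;> simp
  have hdet : T.det = 1 := by
    rw [Matrix.det_of_isUpperTriangular]
    · exact Finset.prod_eq_one fun i _ => by rw [hT i i le_rfl, if_pos rfl]
    · intro i j hij
      rw [hT i j (le_of_lt hij), if_neg (by rintro rfl; exact lt_irrefl _ hij)]
  refine Matrix.eq_zero_of_mulVec_eq_zero (M := T) (by rw [hdet]; exact one_ne_zero) ?_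
  ext r
  exact hc (ρ r) (by simp only [ρ]; omega)

theorem IsBand.finrank_firstCols {n k : ℕ} (hkn : k < n) {A : Matrix (Fin n) (Fin n) ℂ[X]}
    (hA : IsBand (n - k) A) (μ : ℂ) : Module.finrank ℂ (firstCols k (evalAt μ A)) = k := by
  rw [finrank_firstCols_iff hkn.le]
  exact fun c hc => hA.firstBlock_eq_zero hkn μ fun r _ => by rw [hc]; rfl

theorem firstCols_le {n k : ℕ} {A : Matrix (Fin n) (Fin n) ℂ}
    {W : Submodule ℂ (Fin n → ℂ)} (h : ∀ b, (fun a => A a b) ∈ W) : firstCols k A ≤ W := by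
  rw [firstCols, Submodule.span_le]
  rintro _ ⟨j, _, rfl⟩
  exact h j

theorem firstCols_eq_of_mem {n k : ℕ} {A : Matrix (Fin n) (Fin n) ℂ} (N : Gr n k)
    (h : ∀ b, (fun a => A a b) ∈ N.1) (hr : Module.finrank ℂ (firstCols k A) = k) :
    firstCols k A = N.1 :=
  Submodule.eq_of_le_of_finrank_eq (firstCols_le h) (hr.trans N.2.symm)

theorem mem_firstCols {n k : ℕ} (h : k ≤ n) (A : Matrix (Fin n) (Fin n) ℂ) {w : Fin n → ℂ}
    (hw : w ∈ firstCols k A) : ∃ c : Fin k → ℂ, (firstBlock h A).mulVec c = w := by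
  rw [firstCols_eq h, ← Matrix.range_mulVecLin] at hw
  exact hw

/-! ### A banded matrix is determined by the columns of one evaluation -/

/-- A subspace containing the columns of a banded matrix at `μ ≠ 0` has nonzero cyclic Plücker
coordinates. -/
theorem IsBand.isGen {n k : ℕ} (hk : 1 ≤ k) (hkn : k < n) {A : Matrix (Fin n) (Fin n) ℂ[X]}
    (hA : IsBand (n - k) A) {x : X n k}
    (hN : ∀ b, (fun a => evalAt (lam x) A a b) ∈ x.N.1) : IsGen x := by
  suffices h : ∀ b : ℕ, b < n → minor x.N.mat (cyc n k b) ≠ 0 from fun b => h b b.2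
  intro b
  induction b with
  | zero =>
    intro _
    rw [x.N.minor_mat_ne_zero_iff (card_cyc hkn.le (Nat.zero_le _))]
    intro w hw hz
    rw [← firstCols_eq_of_mem x.N hN (hA.finrank_firstCols hkn _)] at hw
    obtain ⟨c, rfl⟩ := mem_firstCols hkn.le _ hw
    rw [hA.firstBlock_eq_zero hkn (lam x) (c := c) fun r hr => hz r (mem_cyc.2 (by omega)),
      Matrix.mulVec_zero]
  | succ b ih =>
    intro hb
    have h1 := ih (by omega)
    rw [x.N.minor_mat_ne_zero_iff (card_cyc hkn.le (by omega))] at h1 ⊢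
    intro w hw hz
    -- The window slides from `cyc n k b` to `cyc n k (b + 1)`, losing row `e` and gaining row `b`.
    -- The column `v` vanishes on the common rows and is nonzero at both `e` and `b`. Subtracting a
    -- multiple of `v` from `w` clears row `e`, so by induction `w` is a multiple of `v`; since `w`
    -- vanishes at row `b`, it is zero.
    let b' : Fin n := ⟨b, by omega⟩
    set v : Fin n → ℂ := fun a => evalAt (lam x) A a b' with hv
    have hpoly : ∀ a : Fin n, a ∈ cyc n (k - 1) b → v a = 0 := by
      intro a ha
      have ha2 := a.2
      rw [mem_cyc] at ha
      have : A a b' = 0 := by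
        ext p
        have hp : p = 0 ∧ n * p = 0 ∨ 0 < p ∧ n ≤ n * p := by
          rcases p with _ | p
          · simp
          · right; exact ⟨by omega, Nat.le_mul_of_pos_right n (by omega)⟩
        have hA' := hA a b' p
        simp only [b'] at hA'
        rw [Polynomial.coeff_zero]
        by_cases h2 : (a : ℕ) + n * p < b
        · exact hA'.1 h2
        · exact hA'.2.2.2 (by omega)
      rw [hv]; simp [evalAt_apply, this]
    have hmon : ∀ a : Fin n, ((a : ℕ) + k = b ∨ (a : ℕ) + k = n + b) → v a ≠ 0 := by
      intro a ha
      have ha2 := a.2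
      -- The entry in row `e` lies on the subdiagonal of ones, so it is `1` or `λ` according to
      -- whether the window wraps; `λ ≠ 0` is needed in the latter case.
      obtain ⟨q, hq⟩ : ∃ q : ℕ, (a : ℕ) + n * q = b + (n - k) := by
        rcases ha with ha | ha
        · exact ⟨1, by omega⟩
        · exact ⟨0, by omega⟩
      have : A a b' = Polynomial.X ^ q := by
        ext p
        have hA' := hA a b' p
        simp only [b'] at hA'
        rw [Polynomial.coeff_X_pow]
        rcases lt_trichotomy p q with h | rfl | h
        · have : n * (p + 1) ≤ n * q := Nat.mul_le_mul_left n h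
          rw [mul_add] at this
          rw [if_neg h.ne, hA'.1 (by omega)]
        · rw [if_pos rfl, hA'.2.2.1 hq]
        · have : n * (q + 1) ≤ n * p := Nat.mul_le_mul_left n h
          rw [mul_add] at this
          rw [if_neg h.ne', hA'.2.2.2 (by omega)]
      rw [hv]
      simp only [evalAt_apply, this, Polynomial.eval_pow, Polynomial.eval_X]
      exact pow_ne_zero _ (lam_ne_zero x)
    have hdiag : v b' ≠ 0 := by
      have : A b' b' = Polynomial.C ((A b' b').coeff 0) := by
        ext p
        rcases p with _ | p
        · simp
        · have := Nat.le_mul_of_pos_right n (Nat.succ_pos p)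
          rw [(hA b' b' (p + 1)).2.2.2 (by rw [← Nat.succ_eq_add_one]; omega), Polynomial.coeff_C, if_neg (by omega)]
      rw [hv]
      simp only [evalAt_apply]
      rw [this, Polynomial.eval_C]
      exact hA.diag_ne_zero b'
    obtain ⟨e, he⟩ : ∃ e : Fin n, (e : ℕ) + k = b ∨ (e : ℕ) + k = n + b := by
      by_cases hbk : k ≤ b
      · exact ⟨⟨b - k, by omega⟩, by simp only; omega⟩
      · exact ⟨⟨n + b - k, by omega⟩, by simp only; omega⟩
    have hins : insert e (cyc n (k - 1) b) = cyc n k b := by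
      rw [insert_cyc (by omega), show k - 1 + 1 = k by omega]
    have hsub := h1 (w - (w e / v e) • v) (x.N.1.sub_mem hw (x.N.1.smul_mem _ (hN b'))) (by
      intro r hr
      rw [← hins, Finset.mem_insert] at hr
      rcases hr with rfl | hr
      · simp only [Pi.sub_apply, Pi.smul_apply, smul_eq_mul]
        rw [div_mul_cancel₀ _ (hmon r he), sub_self]
      · simp only [Pi.sub_apply, Pi.smul_apply, smul_eq_mul]
        rw [hpoly r hr, hz r, mul_zero, sub_zero]
        have : r ∈ insert b' (cyc n (k - 1) b') := Finset.mem_insert_of_mem hr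
        rwa [insert_cyc_self, show k - 1 + 1 = k by omega] at this)
    have hb0 : w b' = 0 := by
      refine hz b' ?_
      have : b' ∈ insert b' (cyc n (k - 1) b') := Finset.mem_insert_self _ _
      rwa [insert_cyc_self, show k - 1 + 1 = k by omega] at this
    have hs0 := congrFun hsub b'
    simp only [Pi.sub_apply, Pi.smul_apply, smul_eq_mul, hb0, zero_sub, Pi.zero_apply,
      neg_eq_zero] at hs0
    rw [(mul_eq_zero.1 hs0).resolve_right hdiag, zero_smul, sub_zero] at hsub
    exact hsub

/-- `g(N|t)` is the only matrix of its band shape whose columns at `λ = (-1)^(k-1) t` lie in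
`N`. -/
theorem IsBand.gMatrix_eq {n k : ℕ} (hk : 1 ≤ k) (hkn : k < n) {A : Matrix (Fin n) (Fin n) ℂ[X]}
    (hA : IsBand (n - k) A) {x : X n k}
    (hN : ∀ b, (fun a => evalAt (lam x) A a b) ∈ x.N.1) : gMatrix x = A := by
  have hx := hA.isGen hk hkn hN
  have hG := isBand_gMatrix hk hkn hx
  -- As `n - k < n`, an entry can contain only one power of `λ`: exponent `0` on or below the
  -- diagonal, `1` above it. One evaluation at a nonzero number therefore determines it.
  have hmono : ∀ (B : Matrix (Fin n) (Fin n) ℂ[X]), IsBand (n - k) B → ∀ a b : Fin n,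
      B a b = Polynomial.monomial (if b ≤ a then 0 else 1)
        ((B a b).coeff (if b ≤ a then 0 else 1)) := by
    intro B hB a b
    have ha := a.2
    have hb := b.2
    ext p
    have hp : p = 0 ∧ n * p = 0 ∨ p = 1 ∧ n * p = n ∨ 2 ≤ p ∧ 2 * n ≤ n * p := by
      rcases p with _ | _ | p
      · simp
      · simp
      · right; right; refine ⟨by omega, ?_⟩; nlinarith
    rw [Polynomial.coeff_monomial]
    have h := hB a b p
    split_ifs with h1 h2 h2
    · rw [← h2]
    · rw [Fin.le_def] at h1
      exact h.2.2.2 (by omega)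
    · rw [← h2]
    · rw [Fin.le_def] at h1
      rcases Nat.lt_or_ge (a + n * p) b with h3 | h3
      · exact h.1 h3
      · exact h.2.2.2 (by omega)
  ext1 a b
  suffices h : evalAt (lam x) (gMatrix x) a b = evalAt (lam x) A a b by
    rw [hmono _ hG a b, hmono _ hA a b]
    rw [evalAt_apply, evalAt_apply, hmono _ hG a b, hmono _ hA a b, Polynomial.eval_monomial,
      Polynomial.eval_monomial] at h
    rw [mul_right_cancel₀ (pow_ne_zero _ (lam_ne_zero x)) h]
  -- In the rows of `cyc n k b` all coefficients of column `b` are prescribed by the band shape, so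
  -- the difference of the two columns is an element of `N` vanishing there.
  have h1 := (x.N.minor_mat_ne_zero_iff (card_cyc hkn.le b.2.le)).1 (hx b)
    ((fun a => evalAt (lam x) (gMatrix x) a b) - fun a => evalAt (lam x) A a b)
    (x.N.1.sub_mem (evalAt_gMatrix_mem hk hkn x b) (hN b)) (by
      intro r hr
      have hr2 := r.2
      have hb2 := b.2
      rw [mem_cyc] at hr
      rw [Pi.sub_apply, sub_eq_zero, evalAt_apply, evalAt_apply]
      congr 1
      ext p
      have hp : p = 0 ∧ n * p = 0 ∨ p = 1 ∧ n * p = n ∨ 2 ≤ p ∧ 2 * n ≤ n * p := by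
        rcases p with _ | _ | p
        · simp
        · simp
        · right; right; refine ⟨by omega, ?_⟩; nlinarith
      have h2 := hG r b p
      have h3 := hA r b p
      rcases Nat.lt_or_ge (r + n * p) b with h4 | h4
      · rw [h2.1 h4, h3.1 h4]
      · rcases Nat.lt_or_ge (b + (n - k)) (r + n * p) with h5 | h5
        · rw [h2.2.2.2 h5, h3.2.2.2 h5]
        · rw [h2.2.2.1 (by omega), h3.2.2.1 (by omega)])
  exact sub_eq_zero.1 (congrFun h1 a)

/-! ### Factoring out `g(N|t)` -/

theorem evalAt_mulVec {n : ℕ} (μ : ℂ) (A : Matrix (Fin n) (Fin n) ℂ[X]) (f : Fin n → ℂ[X]) :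
    (fun a => (A.mulVec f a).eval μ) = (evalAt μ A).mulVec fun a => (f a).eval μ := by
  funext a
  simp [Matrix.mulVec, dotProduct, Polynomial.eval_finsetSum, evalAt]

theorem mulVec_mem {n : ℕ} {A : Matrix (Fin n) (Fin n) ℂ} {W : Submodule ℂ (Fin n → ℂ)}
    (h : ∀ b, (fun a => A a b) ∈ W) (v : Fin n → ℂ) : A.mulVec v ∈ W := by
  have : A.mulVec v = ∑ b, v b • fun a => A a b := by
    funext a
    simp [Matrix.mulVec, dotProduct, mul_comm]
  rw [this]
  exact W.sum_mem fun b _ => W.smul_mem _ (h b)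

theorem mul_mem {n : ℕ} {A : Matrix (Fin n) (Fin n) ℂ} {W : Submodule ℂ (Fin n → ℂ)}
    (h : ∀ b, (fun a => A a b) ∈ W) (B : Matrix (Fin n) (Fin n) ℂ) (b : Fin n) :
    (fun a => (A * B) a b) ∈ W :=
  mulVec_mem h fun i => B i b

/-- Division with remainder by `g(N|t)`: a polynomial vector whose value at `(-1)^(k-1) t` lies in
`N` is in the image of `g(N|t)`. -/
theorem exists_gMatrix_mulVec {n k : ℕ} (hk : 1 ≤ k) (hkn : k < n) {x : X n k} (hx : IsGen x)
    {f : Fin n → ℂ[X]} (hf : (fun a => (f a).eval (lam x)) ∈ x.N.1) :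
    ∃ h, f = (gMatrix x).mulVec h := by
  have hG := isBand_gMatrix hk hkn hx
  have hn : 0 < n := by omega
  -- Induction on a bound for the unfolded positions occupied by `f`. A remainder with all positions
  -- below `n - k` is constant and zero on the last `k` rows, hence zero as an element of `N`.
  suffices H : ∀ B : ℕ, ∀ f : Fin n → ℂ[X], (fun a => (f a).eval (lam x)) ∈ x.N.1 →
      (∀ (a : Fin n) (p : ℕ), B + (n - k) ≤ a + n * p → (f a).coeff p = 0) →
      ∃ h, f = (gMatrix x).mulVec h by
    obtain ⟨d, hd⟩ : ∃ d, ∀ a, (f a).natDegree < d :=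
      ⟨Finset.univ.sup (fun a => (f a).natDegree) + 1, fun a =>
        Nat.lt_succ_of_le (Finset.le_sup (f := fun a => (f a).natDegree) (Finset.mem_univ a))⟩
    refine H (n * (d + 1)) f hf fun a p hp => Polynomial.coeff_eq_zero_of_natDegree_lt ?_
    have h1 : n * d < n * (p + 1) := by
      have := a.2
      rw [mul_add] at hp ⊢; omega
    have := lt_of_mul_lt_mul_left h1 (Nat.zero_le n)
    have := hd a
    omega
  intro B
  induction B with
  | zero =>
    intro f hf hB
    refine ⟨0, ?_⟩
    rw [Matrix.mulVec_zero]
    have hconst : ∀ a, f a = Polynomial.C ((f a).eval (lam x)) := by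
      intro a
      have h1 : f a = Polynomial.C ((f a).coeff 0) := by
        ext p
        rcases p with _ | p
        · simp
        · have := Nat.le_mul_of_pos_right n (Nat.succ_pos p)
          rw [Polynomial.coeff_C, if_neg (by omega), hB a (p + 1) (by
            rw [← Nat.succ_eq_add_one]; omega)]
      conv_rhs => rw [h1]
      rw [Polynomial.eval_C]; exact h1
    have h0 := (x.N.minor_mat_ne_zero_iff (card_cyc hkn.le (Nat.zero_le n))).1 (hx ⟨0, hn⟩) _ hf (by
      intro r hr
      have hr2 := r.2
      rw [mem_cyc] at hr
      have : f r = 0 := by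
        ext p
        exact hB r p (by omega)
      simp [this])
    funext a
    rw [hconst a, congrFun h0 a, Pi.zero_apply, Pi.zero_apply, Polynomial.C_0]
  | succ B ih =>
    intro f hf hB
    obtain ⟨a₁, p₁, h₁⟩ := exists_index hn (B + (n - k))
    obtain ⟨b, q, h₀⟩ := exists_index hn B
    set c := (f a₁).coeff p₁ with hc
    -- A single term at position `B`: its image under `gMatrix x` has the leading term of `f` at
    -- position `B + (n - k)`.
    set e : Fin n → ℂ[X] := Pi.single b (Polynomial.monomial q c) with he
    have hecoeff : ∀ (a : Fin n) (p : ℕ), (b : ℕ) + n * q ≠ a + n * p → (e a).coeff p = 0 := by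
      intro a p h
      by_cases hab : a = b
      · subst hab
        rw [he, Pi.single_eq_same, Polynomial.coeff_monomial, if_neg]
        rintro rfl
        exact h rfl
      · rw [he, Pi.single_eq_of_ne hab, Polynomial.coeff_zero]
    obtain ⟨h, hh⟩ := ih (f - (gMatrix x).mulVec e) (by
        have h2 := congrFun (evalAt_mulVec (lam x) (gMatrix x) e)
        have : (fun a => ((f - (gMatrix x).mulVec e) a).eval (lam x)) =
            (fun a => (f a).eval (lam x)) -
              (evalAt (lam x) (gMatrix x)).mulVec fun a => (e a).eval (lam x) := by
          funext a
          rw [Pi.sub_apply, Pi.sub_apply, Polynomial.eval_sub, ← h2]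
        rw [this]
        exact x.N.1.sub_mem hf (mulVec_mem (evalAt_gMatrix_mem hk hkn x) _))
      (by
        intro a p hap
        rw [Pi.sub_apply, Polynomial.coeff_sub]
        rcases hap.eq_or_lt with hap | hap
        · obtain ⟨rfl, rfl⟩ := index_inj (h₁.trans hap)
          rw [hG.coeff_mulVec_top (f := e) (b := b) (q := q)
            (fun b' q' hlt => hecoeff b' q' hlt.ne) (by omega), he, Pi.single_eq_same,
            Polynomial.coeff_monomial, if_pos rfl, ← hc, sub_self]
        · rw [hB a p (by omega), hG.coeff_mulVec_eq_zero_of_gt (f := e) (r := B)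
            (fun b' q' hlt => hecoeff b' q' (by omega)) (by omega), sub_zero])
    refine ⟨h + e, ?_⟩
    rw [Matrix.mulVec_add, ← hh, sub_add_cancel]

theorem exists_gMatrix_mul {n k : ℕ} (hk : 1 ≤ k) (hkn : k < n) {x : X n k} (hx : IsGen x)
    {A : Matrix (Fin n) (Fin n) ℂ[X]} (hA : ∀ b, (fun a => evalAt (lam x) A a b) ∈ x.N.1) :
    ∃ D, A = gMatrix x * D := by
  choose h hh using fun b => exists_gMatrix_mulVec hk hkn hx (f := fun a => A a b) (hA b)
  refine ⟨fun i j => h j i, ?_⟩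
  ext1 a b
  exact congrFun (hh b) a

/-- The scalar matrix `λ - lam x` vanishes at `lam x`, so `gMatrix x` divides it from the left;
evaluating at `μ` and dividing by `μ - lam x` gives the inverse. -/
theorem exists_evalAt_gMatrix_mul_eq_one {n k : ℕ} (hk : 1 ≤ k) (hkn : k < n) {x : X n k}
    (hx : IsGen x) {μ : ℂ} (hμ : μ ≠ lam x) : ∃ H, evalAt μ (gMatrix x) * H = 1 := by
  obtain ⟨D, hD⟩ := exists_gMatrix_mul hk hkn hx
    (A := (Polynomial.X - Polynomial.C (lam x)) • (1 : Matrix (Fin n) (Fin n) ℂ[X])) (by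
      intro b
      have : (fun a => evalAt (lam x) ((Polynomial.X - Polynomial.C (lam x)) •
          (1 : Matrix (Fin n) (Fin n) ℂ[X])) a b) = 0 := by
        funext a; simp [evalAt_apply]
      rw [this]
      exact x.N.1.zero_mem)
  refine ⟨(μ - lam x)⁻¹ • evalAt μ D, ?_⟩
  rw [Matrix.mul_smul, ← evalAt_mul, ← hD]
  ext a b
  simp only [Matrix.smul_apply, evalAt_apply, smul_eq_mul, Polynomial.eval_mul,
    Polynomial.eval_sub, Polynomial.eval_X, Polynomial.eval_C]
  rw [← mul_assoc, inv_mul_cancel₀ (sub_ne_zero.2 hμ), one_mul, Matrix.one_apply, Matrix.one_apply]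
  split_ifs <;> simp

/-! ### The evaluation-projection and the Schützenberger involution -/

theorem mem_proj_iff {n k : ℕ} (z : ℂˣ) (A : Matrix (Fin n) (Fin n) ℂ[X]) (y : X n k) :
    y ∈ proj k z A ↔ y.t = z ∧ firstCols k (evalAt (lam y) A) = y.N.1 := by
  constructor
  · rintro ⟨h, rfl⟩
    exact ⟨rfl, rfl⟩
  · rintro ⟨rfl, h⟩
    refine ⟨?_, ?_⟩
    · change Module.finrank ℂ (firstCols k (evalAt (lam y) A)) = k
      rw [h]; exact y.N.2
    · exact X.ext (Subtype.ext h) rfl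

theorem mem_proj_of_mem {n k : ℕ} {A : Matrix (Fin n) (Fin n) ℂ[X]} {y : X n k}
    (h : ∀ b, (fun a => evalAt (lam y) A a b) ∈ y.N.1)
    (hr : Module.finrank ℂ (firstCols k (evalAt (lam y) A)) = k) : y ∈ proj k y.t A :=
  (mem_proj_iff _ _ _).2 ⟨rfl, firstCols_eq_of_mem y.N h hr⟩

theorem mem_proj_gMatrix {n k : ℕ} (hk : 1 ≤ k) (hkn : k < n) {x : X n k} (hx : IsGen x) :
    x ∈ proj k x.t (gMatrix x) :=
  mem_proj_of_mem (evalAt_gMatrix_mem hk hkn x)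
    ((isBand_gMatrix hk hkn hx).finrank_firstCols hkn _)

theorem rank_evalAt_gMatrix_le {n k : ℕ} (hk : 1 ≤ k) (hkn : k < n) (x : X n k) :
    (evalAt (lam x) (gMatrix x)).rank ≤ k := by
  have h : LinearMap.range (evalAt (lam x) (gMatrix x)).mulVecLin ≤ x.N.1 := by
    rintro _ ⟨v, rfl⟩
    exact mulVec_mem (evalAt_gMatrix_mem hk hkn x) v
  exact (Submodule.finrank_mono h).trans x.N.2.le

theorem rank_flip {n : ℕ} (A : Matrix (Fin n) (Fin n) ℂ) : (flip A).rank = A.rank := by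
  have : flip A = (A.submatrix Fin.revPerm Fin.revPerm).transpose := by
    ext i j; rfl
  rw [this, Matrix.rank_transpose, Matrix.rank_submatrix]

theorem mem_firstCols_of_rank_le {n k : ℕ} {A : Matrix (Fin n) (Fin n) ℂ} (hA : A.rank ≤ k)
    (hr : Module.finrank ℂ (firstCols k A) = k) (b : Fin n) : (fun a => A a b) ∈ firstCols k A := by
  have hcol : ∀ b, (fun a => A a b) ∈ LinearMap.range A.mulVecLin := by
    intro b
    rw [Matrix.range_mulVecLin]
    exact Submodule.subset_span ⟨b, rfl⟩
  have h1 : firstCols k A = LinearMap.range A.mulVecLin :=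
    Submodule.eq_of_le_of_finrank_le (firstCols_le hcol) (hA.trans hr.ge)
  rw [h1]
  exact hcol b

theorem finrank_firstCols_le_rank {n k : ℕ} (A : Matrix (Fin n) (Fin n) ℂ) :
    Module.finrank ℂ (firstCols k A) ≤ A.rank := by
  refine Submodule.finrank_mono (firstCols_le fun b => ?_)
  rw [Matrix.range_mulVecLin]
  exact Submodule.subset_span ⟨b, rfl⟩

/-- The flip preserves the band shape and the rank at the special value, so the flipped matrix has
all its columns in the span of the first `k`, and uniqueness identifies it with `gMatrix y`. -/
theorem mem_S_iff {n k : ℕ} (hk : 1 ≤ k) (hkn : k < n) {x y : X n k} :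
    y ∈ S x ↔ IsGen x ∧ IsGen y ∧ y.t = x.t ∧ gMatrix y = flip (gMatrix x) := by
  rw [S, Part.mem_bind_iff]
  constructor
  · rintro ⟨A, hA, hy⟩
    obtain ⟨hx, rfl⟩ := (mem_g_iff hkn.le x A).1 hA
    have hB := (isBand_gMatrix hk hkn hx).flip
    obtain ⟨ht, hN⟩ := (mem_proj_iff _ _ _).1 hy
    have hmem : ∀ b, (fun a => evalAt (lam y) (flip (gMatrix x)) a b) ∈ y.N.1 := by
      rw [← hN]
      refine mem_firstCols_of_rank_le ?_ (hB.finrank_firstCols hkn _)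
      rw [evalAt_flip, rank_flip, show lam y = lam x by rw [lam, lam, ht]]
      exact rank_evalAt_gMatrix_le hk hkn x
    exact ⟨hx, hB.isGen hk hkn hmem, ht, hB.gMatrix_eq hk hkn hmem⟩
  · rintro ⟨hx, hy, ht, h⟩
    refine ⟨gMatrix x, (mem_g_iff hkn.le x _).2 ⟨hx, rfl⟩, ?_⟩
    rw [← h, ← ht]
    exact mem_proj_gMatrix hk hkn hy

theorem exists_mem_S {n k : ℕ} (hk : 1 ≤ k) (hkn : k < n) {x : X n k} (hx : IsGen x) :
    ∃ y, y ∈ S x := by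
  refine ⟨⟨⟨firstCols k (evalAt (lam x) (flip (gMatrix x))),
    (isBand_gMatrix hk hkn hx).flip.finrank_firstCols hkn _⟩, x.t⟩, ?_⟩
  rw [S, Part.mem_bind_iff]
  exact ⟨gMatrix x, (mem_g_iff hkn.le x _).2 ⟨hx, rfl⟩, (mem_proj_iff _ _ _).2 ⟨rfl, rfl⟩⟩

theorem mem_S_symm {n k : ℕ} (hk : 1 ≤ k) (hkn : k < n) {x y : X n k} (h : y ∈ S x) : x ∈ S y := by
  obtain ⟨h1, h2, h3, h4⟩ := (mem_S_iff hk hkn).1 h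
  exact (mem_S_iff hk hkn).2 ⟨h2, h1, h3.symm, by rw [h4, flip_flip]⟩

/-! ### The geometric `R`-matrix -/

theorem mem_gProd_iff {n ℓ k : ℕ} (hℓ : ℓ ≤ n) (hk : k ≤ n) (x : X n ℓ × X n k)
    (A : Matrix (Fin n) (Fin n) ℂ[X]) :
    A ∈ gProd x ↔ IsGen x.1 ∧ IsGen x.2 ∧ gMatrix x.1 * gMatrix x.2 = A := by
  simp only [gProd, Part.mem_bind_iff, Part.mem_map_iff, mem_g_iff hℓ, mem_g_iff hk]
  constructor
  · rintro ⟨_, ⟨h1, rfl⟩, _, ⟨h2, rfl⟩, rfl⟩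
    exact ⟨h1, h2, rfl⟩
  · rintro ⟨h1, h2, rfl⟩
    exact ⟨_, ⟨h1, rfl⟩, _, ⟨h2, rfl⟩, rfl⟩

theorem mem_Psi_iff {n ℓ k : ℕ} (hℓ : ℓ ≤ n) (hk : k ≤ n) (x : X n ℓ × X n k) (y : X n k) :
    y ∈ Psi n k ℓ x ↔
      IsGen x.1 ∧ IsGen x.2 ∧ y ∈ proj k x.2.t (gMatrix x.1 * gMatrix x.2) := by
  simp only [Psi, Part.mem_bind_iff, mem_gProd_iff hℓ hk]
  constructor
  · rintro ⟨_, ⟨h1, h2, rfl⟩, h3⟩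
    exact ⟨h1, h2, h3⟩
  · rintro ⟨h1, h2, h3⟩
    exact ⟨_, ⟨h1, h2, rfl⟩, h3⟩

/-- The inner `S` turns the product into `flip (gMatrix x.2) * flip (gMatrix x.1)`, which is the
flip of the original product. -/
theorem mem_R_iff {n ℓ k : ℕ} (hℓ : 1 ≤ ℓ ∧ ℓ < n) (hk : 1 ≤ k ∧ k < n) (x : X n ℓ × X n k)
    (y : X n k × X n ℓ) : y ∈ R n ℓ k x ↔
      IsGen x.1 ∧ IsGen x.2 ∧ y.1 ∈ proj k x.2.t (gMatrix x.1 * gMatrix x.2) ∧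
        ∃ w, w ∈ proj ℓ x.1.t (flip (gMatrix x.1 * gMatrix x.2)) ∧ y.2 ∈ S w := by
  rw [R, PFun.mem_prodLift, mem_Psi_iff hℓ.2.le hk.2.le, and_assoc, and_assoc]
  refine and_congr_right fun hu => and_congr_right fun hv => and_congr_right fun _ => ?_
  have hcomp : y.2 ∈ (S.comp ((Psi n ℓ k).comp SProd)) x ↔
      ∃ w, (∃ q : X n k × X n ℓ, (q.1 ∈ S x.2 ∧ q.2 ∈ S x.1) ∧ w ∈ Psi n ℓ k q) ∧ y.2 ∈ S w := by
    refine Part.mem_bind_iff.trans (exists_congr fun w => and_congr_left fun _ => ?_)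
    refine Part.mem_bind_iff.trans ?_
    exact exists_congr fun q => and_congr_left fun _ => PFun.mem_prodMap
  rw [hcomp]
  simp only [mem_Psi_iff hk.2.le hℓ.2.le]
  constructor
  · rintro ⟨w, ⟨q, ⟨hv1, hv2⟩, h1, h2, h3⟩, h4⟩
    rw [mem_S_iff hk.1 hk.2] at hv1
    rw [mem_S_iff hℓ.1 hℓ.2] at hv2
    rw [hv1.2.2.2, hv2.2.2.2, hv2.2.2.1] at h3
    exact ⟨w, by rw [flip_mul]; exact h3, h4⟩
  · rintro ⟨w, h3, h4⟩
    obtain ⟨v', hv1⟩ := exists_mem_S hk.1 hk.2 hv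
    obtain ⟨u', hv2⟩ := exists_mem_S hℓ.1 hℓ.2 hu
    refine ⟨w, ⟨(v', u'), ⟨hv1, hv2⟩, ?_⟩, h4⟩
    rw [mem_S_iff hk.1 hk.2] at hv1
    rw [mem_S_iff hℓ.1 hℓ.2] at hv2
    refine ⟨hv1.2.1, hv2.2.1, ?_⟩
    simp only
    rw [hv1.2.2.2, hv2.2.2.2, hv2.2.2.1]
    rwa [flip_mul] at h3

theorem finrank_firstCols_mul {n k : ℕ} (hkn : k ≤ n) {P H Q : Matrix (Fin n) (Fin n) ℂ}
    (hP : P * H = 1) (hQ : Module.finrank ℂ (firstCols k Q) = k) :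
    Module.finrank ℂ (firstCols k (P * Q)) = k := by
  rw [finrank_firstCols_iff hkn] at hQ ⊢
  intro c hc
  apply hQ
  have h1 : firstBlock hkn (P * Q) = P * firstBlock hkn Q := rfl
  rw [h1, ← Matrix.mulVec_mulVec] at hc
  have h2 := congrArg H.mulVec hc
  rwa [Matrix.mulVec_mulVec, Matrix.mulVec_zero, mul_eq_one_comm.1 hP, Matrix.one_mulVec] at h2

theorem mem_of_mem_proj {n k : ℕ} {z : ℂˣ} {A : Matrix (Fin n) (Fin n) ℂ[X]} {y : X n k}
    (hy : y ∈ proj k z A) (hA : (evalAt (lam y) A).rank ≤ k) (b : Fin n) :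
    (fun a => evalAt (lam y) A a b) ∈ y.N.1 := by
  obtain ⟨_, h⟩ := (mem_proj_iff _ _ _).1 hy
  have := mem_firstCols_of_rank_le hA (by rw [h]; exact y.N.2) b
  rwa [h] at this

theorem lam_eq {n k : ℕ} {x y : X n k} (h : x.t = y.t) : lam x = lam y := by rw [lam, lam, h]

section

variable {n ℓ k : ℕ} {u : X n ℓ} {v : X n k}

theorem rank_evalAt_prod_le_left (hℓ : 1 ≤ ℓ ∧ ℓ < n) :
    (evalAt (lam u) (gMatrix u * gMatrix v)).rank ≤ ℓ := by
  rw [evalAt_mul]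
  exact (Matrix.rank_mul_le_left _ _).trans (rank_evalAt_gMatrix_le hℓ.1 hℓ.2 u)

theorem rank_evalAt_prod_le_right (hk : 1 ≤ k ∧ k < n) :
    (evalAt (lam v) (gMatrix u * gMatrix v)).rank ≤ k := by
  rw [evalAt_mul]
  exact (Matrix.rank_mul_le_right _ _).trans (rank_evalAt_gMatrix_le hk.1 hk.2 v)

/-- At `lam v` the left factor `gMatrix u` is invertible, so the rank of the first `k` columns is
that for `gMatrix v`. -/
theorem finrank_firstCols_prod (hℓ : 1 ≤ ℓ ∧ ℓ < n) (hk : 1 ≤ k ∧ k < n) (hu : IsGen u)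
    (hv : IsGen v) (h : lam u ≠ lam v) :
    Module.finrank ℂ (firstCols k (evalAt (lam v) (gMatrix u * gMatrix v))) = k := by
  obtain ⟨H, hH⟩ := exists_evalAt_gMatrix_mul_eq_one hℓ.1 hℓ.2 hu h.symm
  rw [evalAt_mul]
  exact finrank_firstCols_mul hk.2.le hH ((isBand_gMatrix hk.1 hk.2 hv).finrank_firstCols hk.2 _)

theorem finrank_firstCols_flip_prod (hℓ : 1 ≤ ℓ ∧ ℓ < n) (hk : 1 ≤ k ∧ k < n) (hu : IsGen u)
    (hv : IsGen v) (h : lam u ≠ lam v) :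
    Module.finrank ℂ (firstCols ℓ (evalAt (lam u) (flip (gMatrix u * gMatrix v)))) = ℓ := by
  obtain ⟨u', hu'⟩ := exists_mem_S hℓ.1 hℓ.2 hu
  obtain ⟨v', hv'⟩ := exists_mem_S hk.1 hk.2 hv
  obtain ⟨-, hu1, hu2, hu3⟩ := (mem_S_iff hℓ.1 hℓ.2).1 hu'
  obtain ⟨-, hv1, hv2, hv3⟩ := (mem_S_iff hk.1 hk.2).1 hv'
  rw [flip_mul, ← hu3, ← hv3, ← lam_eq hu2]
  refine finrank_firstCols_prod hk hℓ hv1 hu1 ?_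
  rw [lam_eq hu2, lam_eq hv2]
  exact h.symm

end

section

variable {n ℓ k : ℕ} {x : X n ℓ × X n k} {y : X n k × X n ℓ}

/-- The `R`-matrix factors `g(u) g(v)` in the opposite order. -/
theorem gMatrix_mul_of_mem_R (hℓ : 1 ≤ ℓ ∧ ℓ < n) (hk : 1 ≤ k ∧ k < n)
    (h : lam x.1 ≠ lam x.2) (hy : y ∈ R n ℓ k x) :
    IsGen y.1 ∧ IsGen y.2 ∧ y.1.t = x.2.t ∧ y.2.t = x.1.t ∧
      gMatrix y.1 * gMatrix y.2 = gMatrix x.1 * gMatrix x.2 := by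
  obtain ⟨hu, hv, hy1, w, hw, hy2⟩ := (mem_R_iff hℓ hk x y).1 hy
  obtain ⟨hwgen, hy2gen, hy2t, hy2g⟩ := (mem_S_iff hℓ.1 hℓ.2).1 hy2
  set A := gMatrix x.1 * gMatrix x.2 with hA
  have hAband : IsBand ((n - ℓ) + (n - k)) A :=
    (isBand_gMatrix hℓ.1 hℓ.2 hu).mul (isBand_gMatrix hk.1 hk.2 hv)
  have hwt := ((mem_proj_iff _ _ _).1 hw).1
  have hy1t := ((mem_proj_iff _ _ _).1 hy1).1
  have hy2lam : lam y.2 = lam x.1 := lam_eq (hy2t.trans hwt)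
  have hwmem := mem_of_mem_proj hw (by
    rw [evalAt_flip, rank_flip, lam_eq hwt]; exact rank_evalAt_prod_le_left hℓ)
  have hy1mem := mem_of_mem_proj hy1 (by
    rw [lam_eq hy1t]; exact rank_evalAt_prod_le_right hk)
  -- Splitting off `gMatrix w` on the left of the flipped product and flipping back splits off
  -- `gMatrix y.2` on the right of `A`.
  obtain ⟨D, hD⟩ := exists_gMatrix_mul hℓ.1 hℓ.2 hwgen hwmem
  have hDband : IsBand (n - k) (flip D) :=
    ((isBand_gMatrix hℓ.1 hℓ.2 hwgen).of_mul_left hAband.flip hD).flip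
  have hfac : A = flip D * gMatrix y.2 := by
    rw [hy2g, ← flip_mul, ← hD, flip_flip]
  -- At `lam y.1` the right factor is invertible, so the columns of `flip D` lie in the column space
  -- of `A`, that is, in `y.1.N`; uniqueness then gives `flip D = gMatrix y.1`.
  obtain ⟨H, hH⟩ := exists_evalAt_gMatrix_mul_eq_one hℓ.1 hℓ.2 hy2gen (μ := lam y.1) (by
    rw [lam_eq hy1t, hy2lam]; exact h.symm)
  have hDmem : ∀ b, (fun a => evalAt (lam y.1) (flip D) a b) ∈ y.1.N.1 := by
    have h1 : evalAt (lam y.1) (flip D) = evalAt (lam y.1) A * H := by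
      rw [hfac, evalAt_mul, mul_assoc, hH, mul_one]
    rw [h1]
    exact mul_mem hy1mem H
  refine ⟨hDband.isGen hk.1 hk.2 hDmem, hy2gen, hy1t, hy2t.trans hwt, ?_⟩
  rw [hDband.gMatrix_eq hk.1 hk.2 hDmem, hfac]

theorem mem_R_symm (hℓ : 1 ≤ ℓ ∧ ℓ < n) (hk : 1 ≤ k ∧ k < n)
    (h : lam x.1 ≠ lam x.2) (hy : y ∈ R n ℓ k x) : x ∈ R n k ℓ y := by
  obtain ⟨hu, hv, -⟩ := (mem_R_iff hℓ hk x y).1 hy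
  obtain ⟨hy1, hy2, ht1, ht2, hA⟩ := gMatrix_mul_of_mem_R hℓ hk h hy
  have h' : lam y.1 ≠ lam y.2 := by
    rw [lam_eq ht1, lam_eq ht2]; exact h.symm
  refine (mem_R_iff hk hℓ y x).2 ⟨hy1, hy2, ?_, ?_⟩
  · rw [ht2]
    refine mem_proj_of_mem ?_ ?_
    · rw [hA, evalAt_mul]
      exact mul_mem (evalAt_gMatrix_mem hℓ.1 hℓ.2 x.1) _
    · rw [← lam_eq ht2]
      exact finrank_firstCols_prod hk hℓ hy1 hy2 h'
  · obtain ⟨v', hv'⟩ := exists_mem_S hk.1 hk.2 hv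
    obtain ⟨-, hv1, hv2, hv3⟩ := (mem_S_iff hk.1 hk.2).1 hv'
    refine ⟨v', ?_, mem_S_symm hk.1 hk.2 hv'⟩
    rw [ht1, ← hv2]
    refine mem_proj_of_mem ?_ ?_
    · rw [hA, flip_mul, ← hv3, evalAt_mul]
      exact mul_mem (evalAt_gMatrix_mem hk.1 hk.2 v') _
    · rw [lam_eq (hv2.trans ht1.symm)]
      exact finrank_firstCols_flip_prod hk hℓ hy1 hy2 h'

/-! ### Coinciding special values -/

/-- At the common value the product has rank at most `min ℓ k`, while the two projections require
ranks `k` and `ℓ`. -/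
theorem eq_of_mem_R_of_lam_eq (hℓ : 1 ≤ ℓ ∧ ℓ < n) (hk : 1 ≤ k ∧ k < n)
    (h : lam x.1 = lam x.2) (hy : y ∈ R n ℓ k x) : ℓ = k := by
  obtain ⟨hu, hv, hy1, w, hw, -⟩ := (mem_R_iff hℓ hk x y).1 hy
  obtain ⟨ht1, hN1⟩ := (mem_proj_iff _ _ _).1 hy1
  obtain ⟨ht2, hN2⟩ := (mem_proj_iff _ _ _).1 hw
  refine le_antisymm ?_ ?_
  · rw [lam_eq ht2, h] at hN2
    have h1 := finrank_firstCols_le_rank (k := ℓ) (evalAt (lam x.2) (flip (gMatrix x.1 * gMatrix x.2)))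
    rw [hN2, w.N.2, evalAt_flip, rank_flip] at h1
    exact h1.trans (rank_evalAt_prod_le_right hk)
  · rw [lam_eq ht1, ← h] at hN1
    have h1 := finrank_firstCols_le_rank (k := k) (evalAt (lam x.1) (gMatrix x.1 * gMatrix x.2))
    rw [hN1, y.1.N.2] at h1
    exact h1.trans (rank_evalAt_prod_le_left hℓ)

end

/-- At the common value the columns of the product lie in the first subspace, so the first
projection can only return `x.1`; the flipped product likewise returns `S` of `x.2`. -/
theorem eq_self_of_mem_R_of_lam_eq {n k : ℕ} {x y : X n k × X n k} (hk : 1 ≤ k ∧ k < n)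
    (h : lam x.1 = lam x.2) (hy : y ∈ R n k k x) : y = x := by
  obtain ⟨hu, hv, hy1, w, hw, hy2⟩ := (mem_R_iff hk hk x y).1 hy
  have ht : x.1.t = x.2.t :=
    Units.ext (mul_left_cancel₀ (pow_ne_zero _ (neg_ne_zero.2 one_ne_zero)) h)
  obtain ⟨ht1, hN1⟩ := (mem_proj_iff _ _ _).1 hy1
  obtain ⟨ht2, hN2⟩ := (mem_proj_iff _ _ _).1 hw
  obtain ⟨v', hv'⟩ := exists_mem_S hk.1 hk.2 hv
  obtain ⟨-, hv1, hv2, hv3⟩ := (mem_S_iff hk.1 hk.2).1 hv'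
  have h1 : x.1 ∈ proj k x.1.t (gMatrix x.1 * gMatrix x.2) := by
    refine mem_proj_of_mem ?_ ?_
    · rw [evalAt_mul]
      exact mul_mem (evalAt_gMatrix_mem hk.1 hk.2 x.1) _
    · rw [h, ← lam_eq ht1, hN1, y.1.N.2]
  have h2 : v' ∈ proj k v'.t (flip (gMatrix x.1 * gMatrix x.2)) := by
    refine mem_proj_of_mem ?_ ?_
    · rw [flip_mul, ← hv3, evalAt_mul]
      exact mul_mem (evalAt_gMatrix_mem hk.1 hk.2 v') _
    · rw [lam_eq (hv2.trans (ht.symm.trans ht2.symm)), hN2, w.N.2]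
  rw [ht] at h1
  rw [hv2, ← ht] at h2
  obtain rfl := Part.mem_unique h2 hw
  exact Prod.ext (Part.mem_unique hy1 h1)
    (Part.mem_unique hy2 (mem_S_symm hk.1 hk.2 hv'))

theorem R_R_eq {n ℓ k : ℕ} (hℓ : 1 ≤ ℓ ∧ ℓ < n) (hk : 1 ≤ k ∧ k < n) {x z : X n ℓ × X n k}
    {y : X n k × X n ℓ} (hy : y ∈ R n ℓ k x) (hz : z ∈ R n k ℓ y) : z = x := by
  by_cases h : lam x.1 = lam x.2
  · obtain rfl := eq_of_mem_R_of_lam_eq hℓ hk h hy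
    obtain rfl := eq_self_of_mem_R_of_lam_eq hk h hy
    exact Part.mem_unique hz hy
  · exact Part.mem_unique hz (mem_R_symm hℓ hk h hy)

/-- Sufficient conditions for `R ∘ R` to be defined. -/
theorem R_R_dom {n ℓ k : ℕ} (hℓ : 1 ≤ ℓ ∧ ℓ < n) (hk : 1 ≤ k ∧ k < n) {x : X n ℓ × X n k}
    (hu : IsGen x.1) (hv : IsGen x.2) (h : lam x.1 ≠ lam x.2)
    (hw : ∀ w ∈ proj ℓ x.1.t (flip (gMatrix x.1 * gMatrix x.2)), IsGen w) :
    (((R n k ℓ).comp (R n ℓ k)) x).Dom := by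
  have h1 : (proj k x.2.t (gMatrix x.1 * gMatrix x.2)).Dom :=
    finrank_firstCols_prod hℓ hk hu hv h
  have h2 : (proj ℓ x.1.t (flip (gMatrix x.1 * gMatrix x.2))).Dom :=
    finrank_firstCols_flip_prod hℓ hk hu hv h
  obtain ⟨y1, hy1⟩ := Part.dom_iff_mem.1 h1
  obtain ⟨w, hw'⟩ := Part.dom_iff_mem.1 h2
  obtain ⟨y2, hy2⟩ := exists_mem_S hℓ.1 hℓ.2 (hw w hw')
  have hy : (y1, y2) ∈ R n ℓ k x := (mem_R_iff hℓ hk x _).2 ⟨hu, hv, hy1, w, hw', hy2⟩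
  rw [Part.dom_iff_mem]
  exact ⟨x, Part.mem_bind hy (mem_R_symm hℓ hk h hy)⟩

/-! ### A point at which `R ∘ R` is defined -/

/-- The cyclic shift matrix, whose `n`-th power is `λ`. -/
def shiftMat (n : ℕ) : Matrix (Fin n) (Fin n) ℂ[X] := fun a b =>
  if (a : ℕ) = b + 1 then 1 else if (b : ℕ) + 1 = n + a then Polynomial.X else 0

theorem flip_shiftMat (n : ℕ) : flip (shiftMat n) = shiftMat n := by
  ext1 a b
  have := a.2
  have := b.2
  simp only [flip, shiftMat, Fin.val_rev]
  refine if_congr (by omega) rfl (if_congr (by omega) rfl rfl)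

theorem flip_algebraMap {n : ℕ} (ζ : ℂ) :
    flip (algebraMap ℂ (Matrix (Fin n) (Fin n) ℂ[X]) ζ) = algebraMap ℂ _ ζ := by
  ext1 a b
  simp only [flip, Matrix.algebraMap_matrix_apply]
  refine if_congr ?_ rfl rfl
  rw [Fin.rev_inj, eq_comm]

theorem flip_sub {n : ℕ} {α : Type} [CommRing α] (A B : Matrix (Fin n) (Fin n) α) :
    flip (A - B) = flip A - flip B := rfl

theorem isBand_shiftMat_sub {n : ℕ} (hn : 2 ≤ n) {ζ : ℂ} (hζ : ζ ≠ 0) :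
    IsBand 1 (shiftMat n - algebraMap ℂ _ ζ) := by
  intro a b p
  have ha := a.2
  have hb := b.2
  have hp : p = 0 ∧ n * p = 0 ∨ p = 1 ∧ n * p = n ∨ 2 ≤ p ∧ 2 * n ≤ n * p := by
    rcases p with _ | _ | p
    · simp
    · simp
    · right; right; refine ⟨by omega, ?_⟩; nlinarith
  have h : (shiftMat n - algebraMap ℂ _ ζ) a b =
      if (a : ℕ) = b then Polynomial.C (-ζ) else if (a : ℕ) = b + 1 then 1 else
        if (b : ℕ) + 1 = n + a then Polynomial.X else 0 := by
    simp only [Matrix.sub_apply, Matrix.algebraMap_matrix_apply, shiftMat, Fin.ext_iff]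
    split_ifs <;> first | omega | simp
  rw [h]
  split_ifs with h1 h2 h3
  · rw [Polynomial.coeff_C]
    refine ⟨fun _ => ?_, fun _ => ?_, fun _ => ?_, fun _ => ?_⟩
    · omega
    · rw [if_pos (by omega)]; exact neg_ne_zero.2 hζ
    · omega
    · rw [if_neg (by omega)]
  · rw [Polynomial.coeff_one]
    refine ⟨fun _ => ?_, fun _ => ?_, fun _ => ?_, fun _ => ?_⟩
    · omega
    · omega
    · rw [if_pos (by omega)]
    · rw [if_neg (by omega)]
  · rw [Polynomial.coeff_X]
    refine ⟨fun _ => ?_, fun _ => ?_, fun _ => ?_, fun _ => ?_⟩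
    · rw [if_neg (by omega)]
    · omega
    · rw [if_pos (by omega)]
    · rw [if_neg (by omega)]
  · rw [Polynomial.coeff_zero]
    refine ⟨fun _ => rfl, fun _ => ?_, fun _ => ?_, fun _ => rfl⟩ <;> omega

theorem isBand_one {n : ℕ} : IsBand 0 (1 : Matrix (Fin n) (Fin n) ℂ[X]) := by
  intro a b p
  have ha := a.2
  have hb := b.2
  have hp : p = 0 ∧ n * p = 0 ∨ 1 ≤ p ∧ n ≤ n * p := by
    rcases p with _ | p
    · simp
    · right; exact ⟨by omega, Nat.le_mul_of_pos_right n (by omega)⟩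
  simp only [Matrix.one_apply, Fin.ext_iff]
  split_ifs with h
  · rw [Polynomial.coeff_one]
    refine ⟨fun _ => ?_, fun _ => ?_, fun _ => ?_, fun _ => ?_⟩
    · omega
    · rw [if_pos (by omega)]; exact one_ne_zero
    · rw [if_pos (by omega)]
    · rw [if_neg (by omega)]
  · rw [Polynomial.coeff_zero]
    refine ⟨fun _ => rfl, fun _ => ?_, fun _ => ?_, fun _ => rfl⟩ <;> omega

/-- The circulant matrix obtained by substituting the shift matrix into `∏_{i<d} (X - ζ i)`. -/
def circ (n : ℕ) (ζ : ℕ → ℂ) (d : ℕ) : Matrix (Fin n) (Fin n) ℂ[X] :=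
  Polynomial.aeval (shiftMat n) (∏ i ∈ Finset.range d, (Polynomial.X - Polynomial.C (ζ i)))

theorem circ_succ (n : ℕ) (ζ : ℕ → ℂ) (d : ℕ) :
    circ n ζ (d + 1) = circ n ζ d * (shiftMat n - algebraMap ℂ _ (ζ d)) := by
  rw [circ, Finset.prod_range_succ, map_mul, ← circ, map_sub, Polynomial.aeval_X,
    Polynomial.aeval_C]

theorem circ_succ' (n : ℕ) (ζ : ℕ → ℂ) (d : ℕ) :
    circ n ζ (d + 1) = (shiftMat n - algebraMap ℂ _ (ζ d)) * circ n ζ d := by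
  rw [circ, Finset.prod_range_succ, mul_comm, map_mul, ← circ, map_sub, Polynomial.aeval_X,
    Polynomial.aeval_C]

theorem circ_mul_comm (n : ℕ) (ζ ξ : ℕ → ℂ) (d e : ℕ) :
    circ n ζ d * circ n ξ e = circ n ξ e * circ n ζ d := by
  rw [circ, circ, ← map_mul, mul_comm, map_mul]

theorem isBand_circ {n : ℕ} (hn : 2 ≤ n) {ζ : ℕ → ℂ} (hζ : ∀ i, ζ i ≠ 0) (d : ℕ) :
    IsBand d (circ n ζ d) := by
  induction d with
  | zero => simpa [circ] using isBand_one
  | succ d ih => rw [circ_succ]; exact ih.mul (isBand_shiftMat_sub hn (hζ d))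

theorem flip_circ (n : ℕ) (ζ : ℕ → ℂ) (d : ℕ) : flip (circ n ζ d) = circ n ζ d := by
  induction d with
  | zero =>
    have := flip_algebraMap (n := n) 1
    simpa [circ] using this
  | succ d ih =>
    rw [circ_succ, flip_mul, ih, flip_sub, flip_shiftMat, flip_algebraMap, ← circ_succ',
      circ_succ]

/-- The row `(1, z, …, z^(n-1))` is a left eigenvector with eigenvalue `z`; the corner entry `λ =
z^n` closes the cycle. -/
theorem vecMul_shiftMat {n : ℕ} {z μ : ℂ} (h : z ^ n = μ) :
    Matrix.vecMul (fun a : Fin n => z ^ (a : ℕ)) (evalAt μ (shiftMat n)) =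
      z • fun a : Fin n => z ^ (a : ℕ) := by
  funext b
  have hb := b.2
  rw [Matrix.vecMul, dotProduct, Pi.smul_apply, smul_eq_mul, ← pow_succ']
  by_cases hbn : (b : ℕ) + 1 < n
  · rw [Finset.sum_eq_single ⟨b + 1, hbn⟩]
    · simp [evalAt_apply, shiftMat]
    · intro a _ hab
      have ha := a.2
      rw [evalAt_apply, shiftMat, if_neg (fun h => hab (Fin.ext h)), if_neg (by omega)]
      simp
    · exact fun h => absurd (Finset.mem_univ _) h
  · rw [Finset.sum_eq_single ⟨0, by omega⟩]
    · rw [evalAt_apply, shiftMat, if_neg (by simp), if_pos (by simp only; omega)]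
      rw [Polynomial.eval_X, pow_zero, one_mul, ← h]
      congr 1
      omega
    · intro a _ hab
      have ha := a.2
      have h0 : (a : ℕ) ≠ 0 := fun h => hab (Fin.ext h)
      rw [evalAt_apply, shiftMat, if_neg (by omega), if_neg (by omega)]
      simp
    · exact fun h => absurd (Finset.mem_univ _) h

theorem vecMul_circ {n : ℕ} {z μ : ℂ} (h : z ^ n = μ) (ζ : ℕ → ℂ) (d : ℕ) :
    Matrix.vecMul (fun a : Fin n => z ^ (a : ℕ)) (evalAt μ (circ n ζ d)) =
      (∏ i ∈ Finset.range d, (z - ζ i)) • fun a : Fin n => z ^ (a : ℕ) := by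
  induction d with
  | zero =>
    have : evalAt μ (circ n ζ 0) = 1 := by
      ext a b
      simp only [circ, Finset.range_zero, Finset.prod_empty, map_one, evalAt_apply]
      rw [Matrix.one_apply, Matrix.one_apply]
      split_ifs <;> simp
    rw [this]
    simp
  | succ d ih =>
    have h1 : evalAt μ (shiftMat n - algebraMap ℂ _ (ζ d)) =
        evalAt μ (shiftMat n) - ζ d • (1 : Matrix (Fin n) (Fin n) ℂ) := by
      ext a b
      simp only [evalAt_apply, Matrix.sub_apply, Matrix.algebraMap_matrix_apply,
        Matrix.smul_apply, Matrix.one_apply, Polynomial.eval_sub]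
      split_ifs <;> simp
    rw [circ_succ, evalAt_mul, ← Matrix.vecMul_vecMul, ih, Matrix.smul_vecMul, h1,
      Matrix.vecMul_sub, vecMul_shiftMat h, Matrix.vecMul_smul, Matrix.vecMul_one, ← sub_smul,
      smul_smul, Finset.prod_range_succ]

/-- The Vandermonde matrix of the `n` distinct roots diagonalizes every polynomial in the shift, and
`d` of the eigenvalues of this one vanish. -/
theorem rank_evalAt_circ_le {n : ℕ} {μ : ℂ} {ζ : ℕ → ℂ} (hζ : ∀ i, ζ i ^ n = μ)
    (hinj : ∀ i < n, ∀ j < n, ζ i = ζ j → i = j) (d : ℕ) :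
    (evalAt μ (circ n ζ d)).rank ≤ n - d := by
  let V : Matrix (Fin n) (Fin n) ℂ := Matrix.vandermonde fun i => ζ i
  have hV : IsUnit V.det := by
    rw [isUnit_iff_ne_zero, Matrix.det_vandermonde_ne_zero_iff]
    exact fun i j hij => Fin.ext (hinj i i.2 j j.2 hij)
  let w : Fin n → ℂ := fun i => ∏ j ∈ Finset.range d, (ζ i - ζ j)
  have hmul : V * evalAt μ (circ n ζ d) = Matrix.diagonal w * V := by
    ext i b
    rw [Matrix.diagonal_mul]
    exact congrFun (vecMul_circ (hζ i) ζ d) b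
  rw [← Matrix.rank_mul_eq_right_of_isUnit_det V _ hV, hmul]
  refine (Matrix.rank_mul_le_left _ _).trans ?_
  rw [Matrix.rank_diagonal, Fintype.card_subtype]
  have hsub : (Finset.univ.filter fun i => w i ≠ 0).map Fin.valEmbedding ⊆ Finset.Ico d n := by
    intro r hr
    simp only [Finset.mem_map, Finset.mem_filter, Finset.mem_univ, true_and,
      Fin.valEmbedding_apply] at hr
    obtain ⟨i, hi, rfl⟩ := hr
    rw [Finset.mem_Ico]
    refine ⟨?_, i.2⟩
    by_contra hcon
    exact hi (Finset.prod_eq_zero (Finset.mem_range.2 (not_le.1 hcon)) (sub_self _))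
  have := Finset.card_le_card hsub
  rwa [Finset.card_map, Nat.card_Ico] at this

/-- The roots are `c ω^i` with `ω` a primitive `n`-th root of unity. A product of `n - m` of the
factors has the right band and rank at most `m` at `λ = c^n`, so it is `gMatrix` of its own column
space. -/
theorem exists_circ_point {n m : ℕ} (hm : 1 ≤ m ∧ m < n) {c : ℂ} (hc : c ≠ 0) :
    ∃ (x : X n m) (ζ : ℕ → ℂ), IsGen x ∧ lam x = c ^ n ∧ gMatrix x = circ n ζ (n - m) := by
  have hn : n ≠ 0 := by omega
  obtain ⟨ω, hω⟩ : ∃ ω : ℂ, IsPrimitiveRoot ω n := ⟨_, Complex.isPrimitiveRoot_exp n hn⟩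
  let ζ : ℕ → ℂ := fun i => c * ω ^ i
  have hζ : ∀ i, ζ i ^ n = c ^ n := by
    intro i
    simp only [ζ]
    rw [mul_pow, ← pow_mul, mul_comm i, pow_mul, hω.pow_eq_one, one_pow, mul_one]
  have hζ0 : ∀ i, ζ i ≠ 0 := fun i => mul_ne_zero hc (pow_ne_zero _ (hω.ne_zero hn))
  have hinj : ∀ i < n, ∀ j < n, ζ i = ζ j → i = j := fun i hi j hj h =>
    hω.pow_inj hi hj (mul_left_cancel₀ hc h)
  have hband := isBand_circ (by omega) hζ0 (n - m) (n := n)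
  let t : ℂˣ := Units.mk0 ((-1) ^ (m - 1) * c ^ n)
    (mul_ne_zero (pow_ne_zero _ (neg_ne_zero.2 one_ne_zero)) (pow_ne_zero _ hc))
  let x : X n m := ⟨⟨firstCols m (evalAt (c ^ n) (circ n ζ (n - m))),
    hband.finrank_firstCols hm.2 _⟩, t⟩
  have hlam : lam x = c ^ n := by
    simp only [lam, x, t, Units.val_mk0]
    rw [← mul_assoc, ← mul_pow]; simp
  have hmem : ∀ b, (fun a => evalAt (lam x) (circ n ζ (n - m)) a b) ∈ x.N.1 := by
    rw [hlam]
    refine mem_firstCols_of_rank_le ?_ (hband.finrank_firstCols hm.2 _)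
    have := rank_evalAt_circ_le hζ hinj (n - m)
    rwa [Nat.sub_sub_self hm.2.le] at this
  exact ⟨x, ζ, hband.isGen hm.1 hm.2 hmem, hlam, hband.gMatrix_eq hm.1 hm.2 hmem⟩

theorem exists_good_point {n ℓ k : ℕ} (hℓ : 1 ≤ ℓ ∧ ℓ < n) (hk : 1 ≤ k ∧ k < n) :
    ∃ x : X n ℓ × X n k, IsGen x.1 ∧ IsGen x.2 ∧ lam x.1 ≠ lam x.2 ∧
      x.1 ∈ proj ℓ x.1.t (flip (gMatrix x.1 * gMatrix x.2)) := by
  obtain ⟨u, ζ, hu, hlu, hgu⟩ := exists_circ_point hℓ (one_ne_zero (α := ℂ))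
  obtain ⟨v, ξ, hv, hlv, hgv⟩ := exists_circ_point hk (two_ne_zero (α := ℂ))
  have hne : lam u ≠ lam v := by
    rw [hlu, hlv, one_pow]
    intro h
    have h1 := congrArg norm h
    rw [norm_one, norm_pow, Complex.norm_ofNat] at h1
    exact (one_lt_pow₀ (one_lt_two (α := ℝ)) (by omega : n ≠ 0)).ne h1
  refine ⟨(u, v), hu, hv, hne, mem_proj_of_mem ?_ (finrank_firstCols_flip_prod hℓ hk hu hv hne)⟩
  have : flip (gMatrix u * gMatrix v) = gMatrix u * gMatrix v := by
    rw [hgu, hgv, flip_mul, flip_circ, flip_circ, circ_mul_comm]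
  simp only
  rw [this, evalAt_mul]
  exact mul_mem (evalAt_gMatrix_mem hℓ.1 hℓ.2 u) _

/-! ### Regular functions on the locus of nonzero cyclic Plücker coordinates -/

section

variable {n ℓ k : ℕ}

/-- Functions given, where all cyclic Plücker coordinates are nonzero, by a quotient of two
bihomogeneous polynomials of the same bidegree. -/
def IsReg (φ : X n ℓ × X n k → ℂ) : Prop :=
  ∃ (F G : MvPolynomial (Coord n ℓ k) ℂ) (d : ℕ × ℕ),
    IsWeightedHomogeneous (bideg n ℓ k) F d ∧ IsWeightedHomogeneous (bideg n ℓ k) G d ∧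
    ∀ x, IsGen x.1 → IsGen x.2 → MvPolynomial.eval (coordVal x) G ≠ 0 ∧
      φ x * MvPolynomial.eval (coordVal x) G = MvPolynomial.eval (coordVal x) F

namespace IsReg

theorem const (c : ℂ) : IsReg fun _ : X n ℓ × X n k => c :=
  ⟨MvPolynomial.C c, 1, 0, MvPolynomial.isWeightedHomogeneous_C _ _,
    MvPolynomial.isWeightedHomogeneous_one _ _, fun x _ _ => by simp⟩

theorem add {φ ψ : X n ℓ × X n k → ℂ} (hφ : IsReg φ) (hψ : IsReg ψ) :
    IsReg fun x => φ x + ψ x := by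
  obtain ⟨F, G, d, hF, hG, h⟩ := hφ
  obtain ⟨F', G', d', hF', hG', h'⟩ := hψ
  refine ⟨F * G' + G * F', G * G', d + d', (hF.mul hG').add (hG.mul hF'), hG.mul hG', ?_⟩
  intro x h1 h2
  obtain ⟨h3, h4⟩ := h x h1 h2
  obtain ⟨h5, h6⟩ := h' x h1 h2
  simp only [map_add, map_mul]
  refine ⟨mul_ne_zero h3 h5, ?_⟩
  rw [← h4, ← h6]; ring

theorem mul {φ ψ : X n ℓ × X n k → ℂ} (hφ : IsReg φ) (hψ : IsReg ψ) :
    IsReg fun x => φ x * ψ x := by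
  obtain ⟨F, G, d, hF, hG, h⟩ := hφ
  obtain ⟨F', G', d', hF', hG', h'⟩ := hψ
  refine ⟨F * F', G * G', d + d', hF.mul hF', hG.mul hG', ?_⟩
  intro x h1 h2
  obtain ⟨h3, h4⟩ := h x h1 h2
  obtain ⟨h5, h6⟩ := h' x h1 h2
  simp only [map_mul]
  refine ⟨mul_ne_zero h3 h5, ?_⟩
  rw [← h4, ← h6]; ring

theorem sub {φ ψ : X n ℓ × X n k → ℂ} (hφ : IsReg φ) (hψ : IsReg ψ) :
    IsReg fun x => φ x - ψ x := by
  have := hφ.add ((const (-1)).mul hψ)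
  simpa [sub_eq_add_neg] using this

theorem sum {ι : Type*} (s : Finset ι) {φ : ι → X n ℓ × X n k → ℂ} (h : ∀ i, IsReg (φ i)) :
    IsReg fun x => ∑ i ∈ s, φ i x := by
  classical
  induction s using Finset.induction_on with
  | empty => simpa using const 0
  | insert i s hi ih => simpa [Finset.sum_insert hi] using (h i).add ih

theorem prod {ι : Type*} (s : Finset ι) {φ : ι → X n ℓ × X n k → ℂ} (h : ∀ i, IsReg (φ i)) :
    IsReg fun x => ∏ i ∈ s, φ i x := by
  classical
  induction s using Finset.induction_on with
  | empty => simpa using const 1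
  | insert i s hi ih => simpa [Finset.prod_insert hi] using (h i).mul ih

theorem minor {m : ℕ} {M : X n ℓ × X n k → Matrix (Fin n) (Fin m) ℂ}
    (h : ∀ a j, IsReg fun x => M x a j) (I : Finset (Fin n)) : IsReg fun x => minor (M x) I := by
  unfold GeomR.minor
  split_ifs with hI
  · simp only [Matrix.det_apply']
    exact sum _ fun σ => (const _).mul (prod _ fun i => h _ _)
  · exact const 0

theorem param₁ : IsReg fun x : X n ℓ × X n k => (x.1.t : ℂ) :=
  ⟨MvPolynomial.X (Sum.inr 0), 1, 0, MvPolynomial.isWeightedHomogeneous_X _ _ _,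
    MvPolynomial.isWeightedHomogeneous_one _ _, fun x _ _ => by simp [coordVal]⟩

theorem param₂ : IsReg fun x : X n ℓ × X n k => (x.2.t : ℂ) :=
  ⟨MvPolynomial.X (Sum.inr 1), 1, 0, MvPolynomial.isWeightedHomogeneous_X _ _ _,
    MvPolynomial.isWeightedHomogeneous_one _ _, fun x _ _ => by simp [coordVal]⟩

theorem ratio₁ (hℓ : ℓ ≤ n) (I : Finset (Fin n)) (b : Fin n) :
    IsReg fun x : X n ℓ × X n k =>
      GeomR.minor x.1.N.mat I / GeomR.minor x.1.N.mat (cyc n ℓ b) := by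
  by_cases hI : I.card = ℓ
  · refine ⟨MvPolynomial.X (Sum.inl (Sum.inl ⟨I, hI⟩)),
      MvPolynomial.X (Sum.inl (Sum.inl ⟨cyc n ℓ b, card_cyc hℓ b.2.le⟩)), (1, 0),
      MvPolynomial.isWeightedHomogeneous_X _ _ _, MvPolynomial.isWeightedHomogeneous_X _ _ _,
      fun x h1 _ => ?_⟩
    simp only [MvPolynomial.eval_X, coordVal]
    exact ⟨h1 b, div_mul_cancel₀ _ (h1 b)⟩
  · have : (fun x : X n ℓ × X n k =>
        GeomR.minor x.1.N.mat I / GeomR.minor x.1.N.mat (cyc n ℓ b)) = fun _ => 0 := by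
      funext x; rw [minor_eq_zero _ hI, zero_div]
    rw [this]; exact const 0

theorem ratio₂ (hk : k ≤ n) (I : Finset (Fin n)) (b : Fin n) :
    IsReg fun x : X n ℓ × X n k =>
      GeomR.minor x.2.N.mat I / GeomR.minor x.2.N.mat (cyc n k b) := by
  by_cases hI : I.card = k
  · refine ⟨MvPolynomial.X (Sum.inl (Sum.inr ⟨I, hI⟩)),
      MvPolynomial.X (Sum.inl (Sum.inr ⟨cyc n k b, card_cyc hk b.2.le⟩)), (0, 1),
      MvPolynomial.isWeightedHomogeneous_X _ _ _, MvPolynomial.isWeightedHomogeneous_X _ _ _,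
      fun x _ h2 => ?_⟩
    simp only [MvPolynomial.eval_X, coordVal]
    exact ⟨h2 b, div_mul_cancel₀ _ (h2 b)⟩
  · have : (fun x : X n ℓ × X n k =>
        GeomR.minor x.2.N.mat I / GeomR.minor x.2.N.mat (cyc n k b)) = fun _ => 0 := by
      funext x; rw [minor_eq_zero _ hI, zero_div]
    rw [this]; exact const 0

theorem evalAt_gMatrix₁ (hℓ : 1 ≤ ℓ ∧ ℓ < n) {μ : X n ℓ × X n k → ℂ} (hμ : IsReg μ)
    (a b : Fin n) : IsReg fun x => evalAt (μ x) (gMatrix x.1) a b := by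
  simp only [evalAt_apply, gMatrix_apply hℓ.1 hℓ.2, Polynomial.eval_mul, Polynomial.eval_C]
  refine mul ?_ (ratio₁ hℓ.2.le _ b)
  split_ifs
  · simpa using const 1
  · simpa using param₁
  · simpa using hμ

theorem evalAt_gMatrix₂ (hk : 1 ≤ k ∧ k < n) {μ : X n ℓ × X n k → ℂ} (hμ : IsReg μ)
    (a b : Fin n) : IsReg fun x => evalAt (μ x) (gMatrix x.2) a b := by
  simp only [evalAt_apply, gMatrix_apply hk.1 hk.2, Polynomial.eval_mul, Polynomial.eval_C]
  refine mul ?_ (ratio₂ hk.2.le _ b)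
  split_ifs
  · simpa using const 1
  · simpa using param₂
  · simpa using hμ

/-- The nonvanishing locus of a regular function is a basic Zariski-open set. -/
theorem exists_nonvanishing_eq (hℓ : ℓ ≤ n) (hk : k ≤ n) {φ : X n ℓ × X n k → ℂ} (h : IsReg φ) :
    ∃ (F : MvPolynomial (Coord n ℓ k) ℂ) (d : ℕ × ℕ), IsWeightedHomogeneous (bideg n ℓ k) F d ∧
      {x | IsGen x.1 ∧ IsGen x.2 ∧ φ x ≠ 0} = nonvanishing F := by
  obtain ⟨F, G, d, hF, -, h⟩ := h
  let P₁ : MvPolynomial (Coord n ℓ k) ℂ := ∏ b : Fin n,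
    MvPolynomial.X (Sum.inl (Sum.inl ⟨cyc n ℓ b, card_cyc hℓ b.2.le⟩))
  let P₂ : MvPolynomial (Coord n ℓ k) ℂ := ∏ b : Fin n,
    MvPolynomial.X (Sum.inl (Sum.inr ⟨cyc n k b, card_cyc hk b.2.le⟩))
  refine ⟨F * (P₁ * P₂), _, hF.mul ((IsWeightedHomogeneous.prod _ _ _ fun b _ =>
    MvPolynomial.isWeightedHomogeneous_X _ _ _).mul (IsWeightedHomogeneous.prod _ _ _ fun b _ =>
    MvPolynomial.isWeightedHomogeneous_X _ _ _)), ?_⟩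
  have e₁ : ∀ x : X n ℓ × X n k, MvPolynomial.eval (coordVal x) P₁ ≠ 0 ↔ IsGen x.1 := by
    intro x
    simp only [P₁, map_prod, MvPolynomial.eval_X, coordVal, Finset.prod_ne_zero_iff,
      Finset.mem_univ, true_imp_iff]
    rfl
  have e₂ : ∀ x : X n ℓ × X n k, MvPolynomial.eval (coordVal x) P₂ ≠ 0 ↔ IsGen x.2 := by
    intro x
    simp only [P₂, map_prod, MvPolynomial.eval_X, coordVal, Finset.prod_ne_zero_iff,
      Finset.mem_univ, true_imp_iff]
    rfl
  ext x
  simp only [nonvanishing, Set.mem_ofPred_eq, map_mul, mul_ne_zero_iff, e₁, e₂]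
  constructor
  · rintro ⟨h1, h2, h3⟩
    obtain ⟨h4, h5⟩ := h x h1 h2
    exact ⟨h5 ▸ mul_ne_zero h3 h4, h1, h2⟩
  · rintro ⟨h3, h1, h2⟩
    refine ⟨h1, h2, fun h0 => h3 ?_⟩
    rw [← (h x h1 h2).2, h0, zero_mul]

end IsReg

/-! ### Irreducibility of the Zariski topology -/

/-- The coordinates attached to two matrices and two numbers. -/
def coordMat {R : Type*} [CommRing R] (A : Matrix (Fin n) (Fin ℓ) R) (B : Matrix (Fin n) (Fin k) R)
    (s t : R) : Coord n ℓ k → R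
  | Sum.inl (Sum.inl I) => (A.submatrix (I.1.orderEmbOfFin I.2) id).det
  | Sum.inl (Sum.inr I) => (B.submatrix (I.1.orderEmbOfFin I.2) id).det
  | Sum.inr i => if i = 0 then s else t

theorem coordVal_eq (x : X n ℓ × X n k) :
    coordVal x = coordMat x.1.N.mat x.2.N.mat (x.1.t : ℂ) (x.2.t : ℂ) := by
  funext c
  rcases c with (I | I) | i
  · simp only [coordVal, coordMat, minor, dif_pos I.2]
  · simp only [coordVal, coordMat, minor, dif_pos I.2]
  · rfl

theorem map_coordMat {R S : Type*} [CommRing R] [CommRing S] (f : R →+* S)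
    (A : Matrix (Fin n) (Fin ℓ) R) (B : Matrix (Fin n) (Fin k) R) (s t : R) (c : Coord n ℓ k) :
    f (coordMat A B s t c) = coordMat (A.map f) (B.map f) (f s) (f t) c := by
  rcases c with (I | I) | i
  · simp only [coordMat, RingHom.map_det, RingHom.mapMatrix_apply, Matrix.submatrix_map]
  · simp only [coordMat, RingHom.map_det, RingHom.mapMatrix_apply, Matrix.submatrix_map]
  · simp only [coordMat]
    split_ifs <;> rfl

/-- Together with `eval_of_isWeightedHomogeneous` this makes nonvanishing of a bihomogeneous
polynomial independent of the chosen bases. -/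
theorem coordMat_mul {R : Type*} [CommRing R] (A : Matrix (Fin n) (Fin ℓ) R)
    (B : Matrix (Fin n) (Fin k) R) (C : Matrix (Fin ℓ) (Fin ℓ) R) (D : Matrix (Fin k) (Fin k) R)
    (s t : R) (c : Coord n ℓ k) : coordMat (A * C) (B * D) s t c =
      C.det ^ (bideg n ℓ k c).1 * D.det ^ (bideg n ℓ k c).2 * coordMat A B s t c := by
  rcases c with (I | I) | i
  · simp only [coordMat, bideg]
    rw [Matrix.submatrix_mul A C _ id id Function.bijective_id, Matrix.submatrix_id_id,
      Matrix.det_mul]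
    ring
  · simp only [coordMat, bideg]
    rw [Matrix.submatrix_mul B D _ id id Function.bijective_id, Matrix.submatrix_id_id,
      Matrix.det_mul]
    ring
  · simp [coordMat, bideg]

theorem eval_of_isWeightedHomogeneous {R σ : Type*} [CommRing R] {w : σ → ℕ × ℕ} {d : ℕ × ℕ}
    {F : MvPolynomial σ R} (hF : IsWeightedHomogeneous w F d) (α β : R) (y : σ → R) :
    MvPolynomial.eval (fun c => α ^ (w c).1 * β ^ (w c).2 * y c) F =
      α ^ d.1 * β ^ d.2 * MvPolynomial.eval y F := by
  rw [MvPolynomial.eval_eq, MvPolynomial.eval_eq, Finset.mul_sum]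
  refine Finset.sum_congr rfl fun m hm => ?_
  have hw := hF (MvPolynomial.mem_support_iff.1 hm)
  rw [Finsupp.weight_apply, Finsupp.sum] at hw
  have h1 : ∑ i ∈ m.support, m i * (w i).1 = d.1 := by
    rw [← hw, Prod.fst_sum]; rfl
  have h2 : ∑ i ∈ m.support, m i * (w i).2 = d.2 := by
    rw [← hw, Prod.snd_sum]; rfl
  have h3 : ∏ i ∈ m.support, (α ^ (w i).1 * β ^ (w i).2 * y i) ^ m i =
      α ^ d.1 * β ^ d.2 * ∏ i ∈ m.support, y i ^ m i := by
    rw [← h1, ← h2, ← Finset.prod_pow_eq_pow_sum, ← Finset.prod_pow_eq_pow_sum,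
      ← Finset.prod_mul_distrib, ← Finset.prod_mul_distrib]
    refine Finset.prod_congr rfl fun i _ => ?_
    rw [mul_pow, mul_pow, ← pow_mul, ← pow_mul, mul_comm (m i), mul_comm (m i)]
  rw [h3]; ring

theorem Gr.exists_leftInverse (N : Gr n k) : ∃ L : Matrix (Fin k) (Fin n) ℂ, L * N.mat = 1 := by
  obtain ⟨f, hf⟩ := LinearMap.exists_leftInverse_of_injective N.mat.mulVecLin
    (LinearMap.ker_eq_bot.2 N.mat_mulVec_injective)
  refine ⟨LinearMap.toMatrix' f, ?_⟩
  have := congrArg LinearMap.toMatrix' hf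
  rwa [LinearMap.toMatrix'_comp, ← Matrix.toLin'_apply', LinearMap.toMatrix'_toLin',
    LinearMap.toMatrix'_id] at this

theorem Gr.exists_eq_mat_mul {A : Matrix (Fin n) (Fin k) ℂ} {L : Matrix (Fin k) (Fin n) ℂ}
    (h : (L * A).det ≠ 0) : ∃ (N : Gr n k) (C : Matrix (Fin k) (Fin k) ℂ),
      A = N.mat * C ∧ C.det ≠ 0 := by
  have hinj : Function.Injective A.mulVecLin := by
    rw [← LinearMap.ker_eq_bot, LinearMap.ker_eq_bot']
    intro c hc
    refine Matrix.eq_zero_of_mulVec_eq_zero h ?_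
    rw [← Matrix.mulVec_mulVec]
    rw [show A.mulVec c = 0 from hc, Matrix.mulVec_zero]
  let N : Gr n k := ⟨LinearMap.range A.mulVecLin, by
    rw [LinearMap.finrank_range_of_inj hinj, Module.finrank_fin_fun]⟩
  obtain ⟨C, hC⟩ := N.exists_mat_mul (B := A) (fun j => by
    change _ ∈ LinearMap.range A.mulVecLin
    rw [Matrix.range_mulVecLin]
    exact Submodule.subset_span ⟨j, rfl⟩)
  refine ⟨N, C, hC, fun h0 => h ?_⟩
  rw [hC, ← Matrix.mul_assoc, Matrix.det_mul, h0, mul_zero]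

/-- The straight line between two elements, parametrized by a polynomial variable. -/
def line (p q : ℂ) : ℂ[X] := Polynomial.C p + Polynomial.X * Polynomial.C (q - p)

theorem eval_line_zero (p q : ℂ) : (line p q).eval 0 = p := by simp [line]

theorem eval_line_one (p q : ℂ) : (line p q).eval 1 = q := by simp [line]

theorem exists_eval_ne_zero {p : ℂ[X]} (h : p ≠ 0) : ∃ τ, p.eval τ ≠ 0 := by
  by_contra hcon
  push Not at hcon
  exact h (Polynomial.funext fun τ => by rw [hcon τ, Polynomial.eval_zero])

theorem ne_zero_of_eval {p : ℂ[X]} {τ : ℂ} (h : p.eval τ ≠ 0) : p ≠ 0 := by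
  rintro rfl
  exact h Polynomial.eval_zero

/-- Two nonempty basic open sets intersect. -/
theorem nonvanishing_inter {F G : MvPolynomial (Coord n ℓ k) ℂ} {d e : ℕ × ℕ}
    (hF : IsWeightedHomogeneous (bideg n ℓ k) F d) (hG : IsWeightedHomogeneous (bideg n ℓ k) G e)
    {x y : X n ℓ × X n k} (hx : x ∈ nonvanishing F) (hy : y ∈ nonvanishing G) :
    (nonvanishing F ∩ nonvanishing G).Nonempty := by
  let A : Matrix (Fin n) (Fin ℓ) ℂ[X] := fun i j => line (x.1.N.mat i j) (y.1.N.mat i j)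
  let B : Matrix (Fin n) (Fin k) ℂ[X] := fun i j => line (x.2.N.mat i j) (y.2.N.mat i j)
  let s : ℂ[X] := line x.1.t y.1.t
  let t : ℂ[X] := line x.2.t y.2.t
  let ev (τ : ℂ) : Coord n ℓ k → ℂ := coordMat (A.map (Polynomial.evalRingHom τ))
    (B.map (Polynomial.evalRingHom τ)) (s.eval τ) (t.eval τ)
  have hev : ∀ (H : MvPolynomial (Coord n ℓ k) ℂ) (τ : ℂ),
      (MvPolynomial.aeval (coordMat A B s t) H).eval τ = MvPolynomial.eval (ev τ) H := by
    intro H τ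
    have h1 := MvPolynomial.comp_aeval_apply (coordMat A B s t) (Polynomial.aeval (R := ℂ) τ) H
    rw [Polynomial.coe_aeval_eq_eval] at h1
    rw [h1, MvPolynomial.aeval_eq_eval]
    congr 2
    funext c
    exact map_coordMat (Polynomial.evalRingHom τ) A B s t c
  have hA0 : A.map (Polynomial.evalRingHom 0) = x.1.N.mat := by
    ext i j; exact eval_line_zero _ _
  have hB0 : B.map (Polynomial.evalRingHom 0) = x.2.N.mat := by
    ext i j; exact eval_line_zero _ _
  have hA1 : A.map (Polynomial.evalRingHom 1) = y.1.N.mat := by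
    ext i j; exact eval_line_one _ _
  have hB1 : B.map (Polynomial.evalRingHom 1) = y.2.N.mat := by
    ext i j; exact eval_line_one _ _
  have hev0 : ev 0 = coordVal x := by
    simp only [ev, hA0, hB0, s, t, eval_line_zero, coordVal_eq]
  have hev1 : ev 1 = coordVal y := by
    simp only [ev, hA1, hB1, s, t, eval_line_one, coordVal_eq]
  -- Nonvanishing of `det (L * A)` certifies full rank along the line. The product below is then a
  -- nonzero polynomial in one variable; each factor is tested at the endpoint `0` or `1`.
  obtain ⟨L, hL⟩ := x.1.N.exists_leftInverse
  obtain ⟨L', hL'⟩ := x.2.N.exists_leftInverse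
  have hdet : ∀ {m : ℕ} (L : Matrix (Fin m) (Fin n) ℂ) (M : Matrix (Fin n) (Fin m) ℂ[X]) (τ : ℂ),
      ((L.map Polynomial.C) * M).det.eval τ = (L * M.map (Polynomial.evalRingHom τ)).det := by
    intro m L M τ
    rw [← Polynomial.coe_evalRingHom, RingHom.map_det, RingHom.mapMatrix_apply, Matrix.map_mul]
    congr 2
    ext i j; simp
  have hne : MvPolynomial.aeval (coordMat A B s t) F * MvPolynomial.aeval (coordMat A B s t) G *
      (s * t) * (((L.map Polynomial.C) * A).det * ((L'.map Polynomial.C) * B).det) ≠ 0 := by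
    refine mul_ne_zero (mul_ne_zero (mul_ne_zero ?_ ?_) (mul_ne_zero ?_ ?_)) (mul_ne_zero ?_ ?_)
    · refine ne_zero_of_eval (τ := 0) ?_
      rw [hev, hev0]; exact hx
    · refine ne_zero_of_eval (τ := 1) ?_
      rw [hev, hev1]; exact hy
    · refine ne_zero_of_eval (τ := 0) ?_
      rw [eval_line_zero]; exact x.1.t.ne_zero
    · refine ne_zero_of_eval (τ := 0) ?_
      rw [eval_line_zero]; exact x.2.t.ne_zero
    · refine ne_zero_of_eval (τ := 0) ?_
      rw [hdet, hA0, hL, Matrix.det_one]; exact one_ne_zero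
    · refine ne_zero_of_eval (τ := 0) ?_
      rw [hdet, hB0, hL', Matrix.det_one]; exact one_ne_zero
  obtain ⟨τ, hτ⟩ := exists_eval_ne_zero hne
  simp only [Polynomial.eval_mul, mul_ne_zero_iff, hev, hdet] at hτ
  obtain ⟨⟨⟨h1, h2⟩, h3, h4⟩, h5, h6⟩ := hτ
  obtain ⟨N, C, hC, hC0⟩ := Gr.exists_eq_mat_mul h5
  obtain ⟨N', C', hC', hC0'⟩ := Gr.exists_eq_mat_mul h6
  let z : X n ℓ × X n k := (⟨N, Units.mk0 _ h3⟩, ⟨N', Units.mk0 _ h4⟩)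
  have hz : ev τ = fun c => C.det ^ (bideg n ℓ k c).1 * C'.det ^ (bideg n ℓ k c).2 *
      coordVal z c := by
    funext c
    simp only [ev, coordVal_eq]
    rw [hC, hC', coordMat_mul]
    rfl
  rw [hz, eval_of_isWeightedHomogeneous hF] at h1
  rw [hz, eval_of_isWeightedHomogeneous hG] at h2
  exact ⟨z, right_ne_zero_of_mul h1, right_ne_zero_of_mul h2⟩

theorem isTopologicalBasis_zariski (n ℓ k : ℕ) :
    @TopologicalSpace.IsTopologicalBasis _ (zariski n ℓ k)
      {U | ∃ (F : MvPolynomial (Coord n ℓ k) ℂ) (d : ℕ × ℕ),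
        IsWeightedHomogeneous (bideg n ℓ k) F d ∧ U = nonvanishing F} := by
  let _ := zariski n ℓ k
  refine ⟨?_, ?_, rfl⟩
  · rintro _ ⟨F, d, hF, rfl⟩ _ ⟨G, e, hG, rfl⟩ x ⟨hx1, hx2⟩
    refine ⟨nonvanishing (F * G), ⟨F * G, d + e, hF.mul hG, rfl⟩, ?_, ?_⟩
    · simp only [nonvanishing, Set.mem_ofPred_eq, map_mul]
      exact mul_ne_zero hx1 hx2
    · intro y hy
      simp only [nonvanishing, Set.mem_ofPred_eq, map_mul] at hy
      exact ⟨left_ne_zero_of_mul hy, right_ne_zero_of_mul hy⟩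
  · refine Set.eq_univ_of_forall fun x => ⟨nonvanishing 1,
      ⟨1, 0, MvPolynomial.isWeightedHomogeneous_one _ _, rfl⟩, ?_⟩
    simp [nonvanishing]

theorem isOpen_nonvanishing {F : MvPolynomial (Coord n ℓ k) ℂ} {d : ℕ × ℕ}
    (hF : IsWeightedHomogeneous (bideg n ℓ k) F d) : @IsOpen _ (zariski n ℓ k) (nonvanishing F) :=
  TopologicalSpace.isOpen_generateFrom_of_mem ⟨F, d, hF, rfl⟩

theorem dense_nonvanishing {F : MvPolynomial (Coord n ℓ k) ℂ} {d : ℕ × ℕ}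
    (hF : IsWeightedHomogeneous (bideg n ℓ k) F d) (hne : (nonvanishing F).Nonempty) :
    @Dense _ (zariski n ℓ k) (nonvanishing F) := by
  let _ := zariski n ℓ k
  rw [(isTopologicalBasis_zariski n ℓ k).dense_iff]
  rintro _ ⟨G, e, hG, rfl⟩ ⟨y, hy⟩
  obtain ⟨x, hx⟩ := hne
  exact nonvanishing_inter hG hF hy hx

/-! ### The domain of `R ∘ R` -/

theorem minor_firstBlock_ne_zero_iff (hk : k ≤ n) {z : ℂˣ} {A : Matrix (Fin n) (Fin n) ℂ[X]}
    {w : X n k} (hw : w ∈ proj k z A) (I : Finset (Fin n)) :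
    minor (firstBlock hk (evalAt (lam w) A)) I ≠ 0 ↔ minor w.N.mat I ≠ 0 := by
  obtain ⟨-, hN⟩ := (mem_proj_iff _ _ _).1 hw
  obtain ⟨C, hC⟩ := w.N.exists_mat_mul (B := firstBlock hk (evalAt (lam w) A)) (fun j => by
    rw [← hN, firstCols_eq hk]
    exact Submodule.subset_span ⟨j, rfl⟩)
  have hC0 : C.det ≠ 0 := by
    intro h0
    obtain ⟨c, hc, hc0⟩ := Matrix.exists_mulVec_eq_zero_iff.2 h0
    have hr := w.N.2
    rw [← hN, finrank_firstCols_iff hk] at hr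
    exact hc (hr c (by rw [hC, ← Matrix.mulVec_mulVec, hc0, Matrix.mulVec_zero]))
  rw [hC, minor_mul, mul_ne_zero_iff, and_iff_left hC0]

theorem exists_open_subset_dom (hℓ : 1 ≤ ℓ ∧ ℓ < n) (hk : 1 ≤ k ∧ k < n) :
    ∃ U : Set (X n ℓ × X n k), @IsOpen _ (zariski n ℓ k) U ∧ @Dense _ (zariski n ℓ k) U ∧
      U ⊆ ((R n k ℓ).comp (R n ℓ k)).Dom := by
  -- An explicit matrix spanning the intermediate point `w`, with regular entries; the basis chosen
  -- by `Gr.mat` has no such regularity.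
  let M : X n ℓ × X n k → Matrix (Fin n) (Fin ℓ) ℂ := fun x =>
    firstBlock hℓ.2.le (evalAt (lam x.1) (flip (gMatrix x.1 * gMatrix x.2)))
  let φ : X n ℓ × X n k → ℂ := fun x =>
    (lam x.1 - lam x.2) * ∏ b : Fin n, minor (M x) (cyc n ℓ b)
  have hlam₁ : IsReg fun x : X n ℓ × X n k => lam x.1 := (IsReg.const _).mul IsReg.param₁
  have hlam₂ : IsReg fun x : X n ℓ × X n k => lam x.2 := (IsReg.const _).mul IsReg.param₂
  have hM : ∀ a j, IsReg fun x => M x a j := by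
    intro a j
    have : (fun x => M x a j) = fun x : X n ℓ × X n k => ∑ c : Fin n,
        evalAt (lam x.1) (gMatrix x.1) (Fin.castLE hℓ.2.le j).rev c *
          evalAt (lam x.1) (gMatrix x.2) c a.rev := by
      funext x
      simp only [M, evalAt_flip, evalAt_mul]
      rfl
    rw [this]
    exact IsReg.sum _ fun c => (IsReg.evalAt_gMatrix₁ hℓ hlam₁ _ _).mul
      (IsReg.evalAt_gMatrix₂ hk hlam₁ _ _)
  have hφ : IsReg φ := (hlam₁.sub hlam₂).mul (IsReg.prod _ fun b => IsReg.minor hM _)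
  obtain ⟨F, d, hF, hU⟩ := hφ.exists_nonvanishing_eq hℓ.2.le hk.2.le
  have hφ0 : ∀ x, φ x ≠ 0 ↔ lam x.1 ≠ lam x.2 ∧ ∀ b : Fin n, minor (M x) (cyc n ℓ b) ≠ 0 := by
    intro x
    simp only [φ, mul_ne_zero_iff, sub_ne_zero, Finset.prod_ne_zero_iff, Finset.mem_univ,
      true_imp_iff]
  have hkey : ∀ x : X n ℓ × X n k, ∀ w ∈ proj ℓ x.1.t (flip (gMatrix x.1 * gMatrix x.2)),
      ((∀ b : Fin n, minor (M x) (cyc n ℓ b) ≠ 0) ↔ IsGen w) := by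
    intro x w hw
    refine forall_congr' fun b => ?_
    rw [← minor_firstBlock_ne_zero_iff hℓ.2.le hw, lam_eq ((mem_proj_iff _ _ _).1 hw).1]
  refine ⟨nonvanishing F, isOpen_nonvanishing hF, dense_nonvanishing hF ?_, ?_⟩
  · obtain ⟨x, hu, hv, hne, hx⟩ := exists_good_point hℓ hk
    refine ⟨x, ?_⟩
    rw [← hU]
    exact ⟨hu, hv, (hφ0 x).2 ⟨hne, (hkey x _ hx).2 hu⟩⟩
  · intro x hx
    rw [← hU] at hx
    obtain ⟨hu, hv, h⟩ := hx
    obtain ⟨hne, hm⟩ := (hφ0 x).1 h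
    exact R_R_dom hℓ hk hu hv hne fun w hw => (hkey x w hw).1 hm

end

end GeomR

end

theorem mainTheorem4 (n ℓ k : ℕ) (hn : 2 ≤ n) (hℓ : 1 ≤ ℓ ∧ ℓ ≤ n - 1) (hk : 1 ≤ k ∧ k ≤ n - 1) :
    GeomR.RatMapEq ((GeomR.R n k ℓ).comp (GeomR.R n ℓ k)) (PFun.id (GeomR.X n ℓ × GeomR.X n k)) := by
  have hℓ' : 1 ≤ ℓ ∧ ℓ < n := ⟨hℓ.1, by omega⟩
  have hk' : 1 ≤ k ∧ k < n := ⟨hk.1, by omega⟩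
  refine ⟨?_, ?_⟩
  · obtain ⟨U, hU, hd, hs⟩ := GeomR.exists_open_subset_dom hℓ' hk'
    exact ⟨U, hU, hd, fun x hx => ⟨hs hx, trivial⟩⟩
  · rintro x ⟨hx, -⟩
    obtain ⟨z, hz⟩ := Part.dom_iff_mem.1 hx
    obtain ⟨y, hy, hz'⟩ := Part.mem_bind_iff.1 hz
    obtain rfl := GeomR.R_R_eq hℓ' hk' hy hz'
    exact (Part.eq_some_iff.2 hz).trans (Part.eq_some_iff.2 (Part.mem_some _)).symm
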